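/- Let $(W,S)$ be a finite Coxeter system with longest element $w_0$, let $\mathbb F$ be a field, and let $H_W(0)$ be the $0$-Hecke algebra: the $\mathbb F$-algebra generated by $\{\pi_s : s\in S\}$ with relations $\pi_s^2=\pi_s$ and $(\pi_s\pi_t\pi_s\cdots)_{m_{st}}=(\pi_t\pi_s\pi_t\cdots)_{m_{st}}$ for distinct $s,t\in S$. Put $\overline\pi_s:=\pi_s-1$. For a reduced expression $w=s_1\cdots s_k$ put $\pi_w:=\pi_{s_1}\cdots\pi_{s_k}$ and $\overline\pi_w:=\overline\pi_{s_1}\cdots\overline\pi_{s_k}$. For $I\subseteq S$ let $I^c:=S\setminus I$, let $w_0(I)$ be the longest element of the parabolic subgroup $W_I$, let $\mathcal P_I:=H_W(0)\,\overline\pi_{w_0(I)}\pi_{w_0(I^c)}$, and let $\mathcal C_I$ be the top of $\mathcal P_I$, i.e. its quotient by the intersection of its maximal submodules. There is a unique permutation $\sigma$ of $S$ with $\sigma(s)=w_0sw_0$ for all $s\in S$, and it preserves the Coxeter matrix. The rules $\theta:\pi_s\mapsto 1-\pi_s$ and $\phi:\pi_s\mapsto\pi_{w_0sw_0}=\pi_{\sigma(s)}$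 ($s\in S$) define two commuting involutive $\mathbb F$-algebra automorphisms of $H_W(0)$. For an automorphism $f$ of $H_W(0)$ and an $H_W(0)$-module $M$, let $f[M]$ be $M$ with each $a$ acting as $f(a)$, and for a left ideal $M$ let $f(M)$ be its image under $f$. Then for every $I\subseteq S$ there are isomorphisms (and an equality of left ideals) of $H_W(0)$-modules $$\theta(\mathcal P_I)\cong\mathcal P_{I^c}\cong\theta[\mathcal P_I],\qquad \phi(\mathcal P_I)=\mathcal P_{\sigma(I)}\cong\phi[\mathcal P_I].$$ Moreover, let $(W,S)$ be of type $A_{n-1}$ (so $W\cong\mathfrak S_n$), with $S=\{s_1,\dots,s_{n-1}\}$ numbered along the Coxeter diagram. Then $\phi(\pi_{s_i})=\pi_{s_{n-i}}$ for all $i$. For a composition $\alpha=(\alpha_1,\dots,\alpha_\ell)$ of $n$ let $D(\alpha)=\{\alpha_1,\alpha_1+\alpha_2,\dots,\alpha_1+\cdots+\alpha_{\ell-1}\}$, and let $\mathcal P_\alpha:=\mathcal P_I$ and $\mathcal C_\alpha:=\mathcal C_I$ with $I=\{s_i:i\in D(\alpha)\}$. Let $\alpha^t$ be the transpose of $\alpha$,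 i.e. the reverse of the composition of $n$ with descent set $\{1,\dots,n-1\}\setminus D(\alpha)$. Then for every composition $\alpha$ of $n$ $$\phi\circ\theta[\mathcal C_\alpha]\cong\mathcal C_{\alpha^t}\quad\text{and}\quad \phi\circ\theta(\mathcal P_\alpha)\cong\phi\circ\theta[\mathcal P_\alpha]\cong\mathcal P_{\alpha^t}.$$ -/

import Mathlib

noncomputable section

/-! ### The 0-Hecke algebra of a Coxeter matrix -/

section HeckeZero

variable (F : Type*) [Field F] {B : Type*} (M : CoxeterMatrix B)

/-- Defining relations of the 0-Hecke algebra: the generators are idempotent, and the two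
alternating products of `M i j` factors in the `i`-th and `j`-th generators agree.
(For `i = j` the second relation is trivial.) -/
inductive HeckeZero.Rel : FreeAlgebra F B → FreeAlgebra F B → Prop
  | idem (i : B) :
      HeckeZero.Rel (FreeAlgebra.ι F i * FreeAlgebra.ι F i) (FreeAlgebra.ι F i)
  | braid (i j : B) :
      HeckeZero.Rel
        ((CoxeterSystem.alternatingWord i j (M i j)).map (FreeAlgebra.ι F)).prod
        ((CoxeterSystem.alternatingWord j i (M i j)).map (FreeAlgebra.ι F)).prod

/-- The 0-Hecke algebra `H_W(0)` over the field `F`, by generators and relations. -/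
def HeckeZero : Type _ := RingQuot (HeckeZero.Rel F M)

namespace HeckeZero

instance : Ring (HeckeZero F M) := inferInstanceAs (Ring (RingQuot (HeckeZero.Rel F M)))

instance : Algebra F (HeckeZero F M) :=
  inferInstanceAs (Algebra F (RingQuot (HeckeZero.Rel F M)))

/-- The quotient map from the free algebra. -/
def mk : FreeAlgebra F B →ₐ[F] HeckeZero F M := RingQuot.mkAlgHom F (HeckeZero.Rel F M)

/-- The generator `π_i`. -/
def gen (i : B) : HeckeZero F M := mk F M (FreeAlgebra.ι F i)

/-- The generator `π̄_i = π_i - 1`. -/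
def genBar (i : B) : HeckeZero F M := gen F M i - 1

theorem gen_mul_self (i : B) : gen F M i * gen F M i = gen F M i := by
  have h : mk F M _ = mk F M _ := RingQuot.mkAlgHom_rel F (Rel.idem (F := F) (M := M) i)
  rwa [map_mul] at h

theorem braid (i j : B) :
    ((CoxeterSystem.alternatingWord i j (M i j)).map (gen F M)).prod =
      ((CoxeterSystem.alternatingWord j i (M i j)).map (gen F M)).prod := by
  have h : mk F M _ = mk F M _ := RingQuot.mkAlgHom_rel F (Rel.braid (F := F) (M := M) i j)
  rwa [map_list_prod, map_list_prod, List.map_map, List.map_map] at h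

variable {F M}

/-- The universal property of the 0-Hecke algebra. -/
def lift {A : Type*} [Ring A] [Algebra F A] (f : B → A) (h1 : ∀ i, f i * f i = f i)
    (h2 : ∀ i j, ((CoxeterSystem.alternatingWord i j (M i j)).map f).prod =
      ((CoxeterSystem.alternatingWord j i (M i j)).map f).prod) : HeckeZero F M →ₐ[F] A :=
  RingQuot.liftAlgHom F ⟨FreeAlgebra.lift F f, by
    rintro _ _ (i | ⟨i, j⟩)
    · simp [h1]
    · have e : (⇑(FreeAlgebra.lift F f) ∘ FreeAlgebra.ι F) = f := FreeAlgebra.ι_comp_lift f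
      rw [map_list_prod, map_list_prod, List.map_map, List.map_map, e]
      exact h2 i j⟩

theorem lift_gen {A : Type*} [Ring A] [Algebra F A] (f : B → A) (h1 : ∀ i, f i * f i = f i)
    (h2 : ∀ i j, ((CoxeterSystem.alternatingWord i j (M i j)).map f).prod =
      ((CoxeterSystem.alternatingWord j i (M i j)).map f).prod) (i : B) :
    lift f h1 h2 (gen F M i) = f i := by
  have h := RingQuot.liftAlgHom_mkAlgHom_apply F (s := Rel F M) (FreeAlgebra.lift F f) (by
    rintro _ _ (i | ⟨i, j⟩)
    · simp [h1]
    · have e : (⇑(FreeAlgebra.lift F f) ∘ FreeAlgebra.ι F) = f := FreeAlgebra.ι_comp_lift f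
      rw [map_list_prod, map_list_prod, List.map_map, List.map_map, e]
      exact h2 i j) (FreeAlgebra.ι F i)
  exact h.trans (FreeAlgebra.lift_ι_apply f i)

theorem algHom_ext {A : Type*} [Ring A] [Algebra F A] {f g : HeckeZero F M →ₐ[F] A}
    (h : ∀ i, f (gen F M i) = g (gen F M i)) : f = g := by
  refine RingQuot.ringQuot_ext' F f g (FreeAlgebra.hom_ext ?_)
  funext i
  exact h i

theorem alternatingWord_map_prod_succ {A : Type*} [Monoid A] (f : B → A) (i j : B) (k : ℕ) :
    ((CoxeterSystem.alternatingWord i j (k + 1)).map f).prod =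
      ((CoxeterSystem.alternatingWord j i k).map f).prod * f j := by
  rw [CoxeterSystem.alternatingWord_succ]
  simp

theorem compl_alternating_mul {A : Type*} [Ring A] (f : B → A) (hf : ∀ i, f i * f i = f i)
    (k : ℕ) : ∀ i j : B,
    ((CoxeterSystem.alternatingWord j i (k + 1)).map (fun l => 1 - f l)).prod * f j =
      (-1) ^ (k + 1) * (((CoxeterSystem.alternatingWord i j (k + 2)).map f).prod -
        ((CoxeterSystem.alternatingWord i j (k + 1)).map f).prod) := by
  induction k with
  | zero =>
    intro i j
    simp [CoxeterSystem.alternatingWord]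
    noncomm_ring
  | succ k ih =>
    intro i j
    have h0 : ((CoxeterSystem.alternatingWord i j (k + 1)).map (fun l => 1 - f l)).prod * f j
        = 0 := by
      rw [alternatingWord_map_prod_succ, mul_assoc, sub_mul, one_mul, hf, sub_self, mul_zero]
    rw [alternatingWord_map_prod_succ (fun l => 1 - f l) j i (k + 1), mul_sub, mul_one, sub_mul,
      h0, ih j i, alternatingWord_map_prod_succ f i j (k + 2),
      alternatingWord_map_prod_succ f i j (k + 1), pow_succ _ (k + 1)]
    noncomm_ring

theorem compl_alternating_sub {A : Type*} [Ring A] (f : B → A) (hf : ∀ i, f i * f i = f i)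
    (i j : B) (k : ℕ) :
    ((CoxeterSystem.alternatingWord i j k).map (fun l => 1 - f l)).prod -
      ((CoxeterSystem.alternatingWord j i k).map (fun l => 1 - f l)).prod =
      (-1) ^ k * (((CoxeterSystem.alternatingWord i j k).map f).prod -
        ((CoxeterSystem.alternatingWord j i k).map f).prod) := by
  induction k with
  | zero => simp [CoxeterSystem.alternatingWord]
  | succ k ih =>
    rcases k with _ | k
    · simp [CoxeterSystem.alternatingWord]
    · have hX := alternatingWord_map_prod_succ (fun l => 1 - f l) i j (k + 1)
      have hY := alternatingWord_map_prod_succ (fun l => 1 - f l) j i (k + 1)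
      rw [mul_sub, mul_one, compl_alternating_mul f hf k i j] at hX
      rw [mul_sub, mul_one, compl_alternating_mul f hf k j i] at hY
      rw [sub_eq_iff_eq_add] at ih
      rw [hX, hY, ih, pow_succ _ (k + 1)]
      noncomm_ring

variable (F M)

/-- The endomorphism `π_i ↦ 1 - π_i`. -/
def thetaHom : HeckeZero F M →ₐ[F] HeckeZero F M :=
  lift (fun i => 1 - gen F M i)
    (fun i => by rw [sub_mul, one_mul, mul_sub, mul_one, gen_mul_self, sub_self, sub_zero])
    (fun i j => by
      have h := compl_alternating_sub (gen F M) (gen_mul_self F M) i j (M i j)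
      rw [braid F M i j, sub_self, mul_zero] at h
      exact sub_eq_zero.mp h)

theorem thetaHom_gen (i : B) : thetaHom F M (gen F M i) = 1 - gen F M i := lift_gen _ _ _ i

theorem thetaHom_comp : (thetaHom F M).comp (thetaHom F M) = AlgHom.id F (HeckeZero F M) := by
  apply algHom_ext
  intro i
  simp [thetaHom_gen]

/-- The automorphism `θ : π_i ↦ 1 - π_i` of the 0-Hecke algebra. -/
def theta : HeckeZero F M ≃ₐ[F] HeckeZero F M :=
  AlgEquiv.ofAlgHom (thetaHom F M) (thetaHom F M) (thetaHom_comp F M) (thetaHom_comp F M)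

theorem theta_gen (i : B) : theta F M (gen F M i) = 1 - gen F M i := thetaHom_gen F M i

end HeckeZero

end HeckeZero

/-! ### Twisting modules and taking images of left ideals -/

section Twisting

variable {F H : Type*} [CommRing F] [Ring H] [Algebra F H]

/-- `Twist f N` is the module `f[N]`: the abelian group `N`, on which `a` acts as `f a`
acts on `N`. -/
def Twist (_f : H ≃ₐ[F] H) (N : Type*) : Type _ := N

namespace Twist

variable (f : H ≃ₐ[F] H) (N : Type*) [AddCommGroup N] [Module H N]

instance : AddCommGroup (Twist f N) := inferInstanceAs (AddCommGroup N)

instance : Module H (Twist f N) := Module.compHom N (f : H →+* H)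

/-- The identity map, regarded as an additive equivalence between `N` and `f[N]`. -/
def of : N ≃+ Twist f N := AddEquiv.refl N

theorem smul_of (a : H) (x : N) : a • of f N x = of f N (f a • x) := rfl

end Twist

/-- The left ideal `f(P)`, the image of the left ideal `P` under the automorphism `f`. -/
def imageIdeal (f : H ≃ₐ[F] H) (P : Submodule H H) : Submodule H H where
  carrier := f '' (P : Set H)
  add_mem' := by
    rintro _ _ ⟨a, ha, rfl⟩ ⟨b, hb, rfl⟩
    exact ⟨a + b, P.add_mem ha hb, map_add f a b⟩
  zero_mem' := ⟨0, P.zero_mem, map_zero f⟩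
  smul_mem' := by
    rintro c _ ⟨a, ha, rfl⟩
    exact ⟨f.symm c • a, P.smul_mem _ ha, by simp⟩

end Twisting

/-! ### Finite Coxeter systems and the modules `P_I` -/

namespace CoxeterSystem

section

variable {B W : Type*} [Group W] {M : CoxeterMatrix B} (cs : CoxeterSystem M W)

/-- The parabolic subgroup `W_I` generated by `I`. -/
def parabolic (I : Set B) : Subgroup W := Subgroup.closure (cs.simple '' I)

theorem exists_longest [Finite W] (I : Set B) :
    ∃ w ∈ cs.parabolic I, ∀ v ∈ cs.parabolic I, cs.length v ≤ cs.length w :=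
  Set.exists_max_image (cs.parabolic I : Set W) cs.length (Set.toFinite _)
    ⟨1, (cs.parabolic I).one_mem⟩

/-- `w₀(I)`, the longest element of the parabolic subgroup `W_I` of a finite Coxeter group. -/
def longest [Finite W] (I : Set B) : W := (cs.exists_longest I).choose

/-- A reduced expression of `w`. -/
def reducedExpr (w : W) : List B := (cs.exists_isReduced w).choose

variable (F : Type*) [Field F]

/-- `π_w`, the product of the generators `π_i` along a reduced expression of `w`. -/
def pi (w : W) : HeckeZero F M := ((cs.reducedExpr w).map (HeckeZero.gen F M)).prod

/-- `π̄_w`, the product of the elements `π̄_i` along a reduced expression of `w`. -/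
def piBar (w : W) : HeckeZero F M := ((cs.reducedExpr w).map (HeckeZero.genBar F M)).prod

/-- The left ideal `P_I = H_W(0) π̄_{w₀(I)} π_{w₀(Iᶜ)}`. -/
def proj [Finite W] (I : Set B) : Submodule (HeckeZero F M) (HeckeZero F M) :=
  Submodule.span (HeckeZero F M) {cs.piBar F (cs.longest I) * cs.pi F (cs.longest Iᶜ)}

/-- The simple module `C_I`, the top of `P_I`: its quotient by the intersection of all of its
maximal submodules. -/
abbrev top [Finite W] (I : Set B) : Type _ :=
  cs.proj F I ⧸ Module.jacobson (HeckeZero F M) (cs.proj F I)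

/-- `φ` is the automorphism `π_s ↦ π_{w₀ s w₀}` of the 0-Hecke algebra. -/
def IsPhi [Finite W] (φ : HeckeZero F M ≃ₐ[F] HeckeZero F M) : Prop :=
  ∀ i, φ (HeckeZero.gen F M i) =
    cs.pi F (cs.longest Set.univ * cs.simple i * cs.longest Set.univ)

/-- `σ` is the permutation of the simple generators given by `w₀ s_i w₀ = s_{σ i}`. -/
def IsSigma [Finite W] (σ : Equiv.Perm B) : Prop :=
  ∀ i, cs.longest Set.univ * cs.simple i * cs.longest Set.univ = cs.simple (σ i)

end

end CoxeterSystem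

/-! ### Compositions -/

namespace Composition

variable {n : ℕ}

/-- The descent set `{α₁, α₁ + α₂, …, α₁ + ⋯ + α_{ℓ-1}}` of a composition of `n`, where the
element `i : Fin (n - 1)` stands for the number `i + 1` in `{1, …, n - 1}`. -/
def descentSet (c : Composition n) : Set (Fin (n - 1)) :=
  {i | ∃ k, 0 < k ∧ k < c.length ∧ c.sizeUpTo k = (i : ℕ) + 1}

theorem descentSet_eq (c : Composition n) :
    c.descentSet = (compositionAsSetEquiv n (compositionEquiv n c) : Set (Fin (n - 1))) := by
  ext i
  have hi := i.2
  simp only [descentSet, compositionAsSetEquiv, compositionEquiv, Equiv.coe_fn_mk,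
    toCompositionAsSet_boundaries, Set.mem_ofPred_eq, boundaries, Finset.mem_map, Finset.mem_univ,
    true_and, Set.coe_toFinset]
  constructor
  · rintro ⟨k, _, hk, h⟩
    refine ⟨⟨k, by omega⟩, ?_⟩
    ext
    simp [boundary, h, add_comm]
  · rintro ⟨k, h⟩
    have h' : c.sizeUpTo k = (i : ℕ) + 1 := by
      have := congrArg Fin.val h
      simpa [boundary, add_comm] using this
    refine ⟨k, ?_, ?_, h'⟩
    · rcases Nat.eq_zero_or_pos (k : ℕ) with h0 | h0
      · rw [h0, sizeUpTo_zero] at h'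
        omega
      · exact h0
    · by_contra hk
      rw [c.sizeUpTo_ofLength_le k (not_lt.mp hk)] at h'
      omega

theorem descentSet_injective : Function.Injective (descentSet (n := n)) := by
  intro c d h
  rw [descentSet_eq, descentSet_eq] at h
  exact (compositionEquiv n).injective ((compositionAsSetEquiv n).injective
    (Finset.coe_injective h))

/-- The complement `αᶜ`: the composition of `n` with the complementary descent set. -/
def complement (c : Composition n) : Composition n :=
  (compositionEquiv n).symm ((compositionAsSetEquiv n).symm
    (compositionAsSetEquiv n (compositionEquiv n c))ᶜ)

theorem descentSet_complement (c : Composition n) : c.complement.descentSet = c.descentSetᶜ := by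
  rw [descentSet_eq, descentSet_eq, complement]
  simp

/-- The transpose `αᵗ`: the reverse of the complement of `α`. -/
def transpose (c : Composition n) : Composition n := c.complement.reverse

end Composition

end

/-! Put `b = π_{w₀(I)}` and `a = θ(π_{w₀(Iᶜ)})`. Since `π̄_s = -θ(π_s)`, signs do not affect the
left ideals, and `θ(P_I) = H b a` while `P_{Iᶜ} = H a b`. Right multiplication by `b` maps `H b a`
into `H a b`. It is bijective once `y (ba)² = 0` forces `y ba = 0` and `ab` lies in `H (ab)²`
(`nonempty_span_mul_equiv`).

Both conditions come from triangularity with respect to length. For `c = ba` and `u` in `W` one has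
`π_u b = π_w` with `ℓ(w) ≥ ℓ(u)`. Then `π_w a` is zero if `w` has a right descent in `Iᶜ`, and is
`π_w` plus longer terms otherwise. So `c` acts on the right like an idempotent, up to an error `z c`
with `z` deeper in the length filtration (`exists_mem_lengthFiltration_mul_sub_eq`), and the
filtration of a finite group ends at zero. Everything is symmetric in `π_s` and `1 - π_s`, so `ab`
is covered too. The `π_w` only have to span; their independence plays no role.

That `π_w` multiplies as expected is Matsumoto's theorem (`IsBraided.prod_eq`). It rests on the
exchange property, obtained from an action of `W` on `W × ℤ/2`, and on `m_st` being the exact order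
of `st`, obtained from the geometric representation.

For `φ`, the formula `ℓ(w₀ w) = ℓ(w₀) - ℓ(w)` shows that conjugation by `w₀` preserves length, hence
permutes the simple reflections. So `φ` permutes the generators of the algebra and carries the
generator of `P_I` (up to sign) to that of `P_{σ(I)}`. For an involution `f`, applying `f`
identifies `f(P)` with `f[P]`, and twisting commutes with taking tops. In type A, `w₀` acts on `{0,
…, n-1}` by a nontrivial permutation that preserves adjacency, which must be the reversal. -/

/-! ### Inversions, exchange and deletion, and the longest element -/

namespace CoxeterSystem

variable {B W : Type*} [Group W] {M : CoxeterMatrix B} (cs : CoxeterSystem M W)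

open Classical in
/-- The involution `(t, ε) ↦ (s_i t s_i, ε + [t = s_i])` of `W × ℤ/2`. -/
noncomputable def reflectionPerm (i : B) : Equiv.Perm (W × ZMod 2) :=
  Function.Involutive.toPerm
    (fun p => (cs.simple i * p.1 * cs.simple i, p.2 + if p.1 = cs.simple i then 1 else 0)) (by
      rintro ⟨t, ε⟩
      have h : cs.simple i * t * cs.simple i = cs.simple i ↔ t = cs.simple i := by
        constructor
        · intro h
          have h' := congrArg (fun x => cs.simple i * (x * cs.simple i)) h
          simpa [mul_assoc] using h'
        · rintro rfl
          simp
      ext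
      · simp [mul_assoc]
      · simp only [h, add_assoc]
        split_ifs
        · rw [show (1 + 1 : ZMod 2) = 0 from rfl, add_zero]
        · simp)

open Classical in
theorem reflectionPerm_apply (i : B) (t : W) (ε : ZMod 2) :
    cs.reflectionPerm i (t, ε) =
      (cs.simple i * t * cs.simple i, ε + if t = cs.simple i then 1 else 0) := rfl

open Classical in
theorem prod_reflectionPerm_apply (ω : List B) (t : W) (ε : ZMod 2) :
    (ω.map cs.reflectionPerm).prod (t, ε) =
      (cs.wordProd ω * t * (cs.wordProd ω)⁻¹, ε + ((cs.rightInvSeq ω).count t : ZMod 2)) := by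
  induction ω with
  | nil => simp
  | cons i ω ih =>
    rw [List.map_cons, List.prod_cons, Equiv.Perm.mul_apply, ih, reflectionPerm_apply]
    ext
    · simp [wordProd_cons, mul_assoc]
    · have h : cs.wordProd ω * t * (cs.wordProd ω)⁻¹ = cs.simple i ↔
          (cs.wordProd ω)⁻¹ * cs.simple i * cs.wordProd ω = t := by
        constructor
        · intro h
          rw [← h]
          group
        · rintro rfl
          group
      simp only [rightInvSeq, List.count_cons, beq_iff_eq, h, Nat.cast_add, Nat.cast_ite,
        Nat.cast_one, Nat.cast_zero, add_assoc]

theorem reverse_alternatingWord_two_mul (i j : B) (m : ℕ) :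
    (alternatingWord i j (2 * m)).reverse = alternatingWord j i (2 * m) := by
  apply List.ext_getElem
  · simp
  · intro k h1 h2
    simp only [List.length_reverse, length_alternatingWord] at h1 h2
    rw [List.getElem_reverse, getElem_alternatingWord _ _ _ _ (by simp; omega),
      getElem_alternatingWord _ _ _ _ h2, length_alternatingWord]
    grind

open Classical in
-- As `(s_i s_j) ^ m = 1`, the two halves of the inversion sequence of an alternating word of length
-- `2m` coincide, so every reflection occurs an even number of times. This is the relation needed to
-- extend `reflectionPerm` to `W`.
theorem count_rightInvSeq_alternatingWord (i j : B) (t : W) :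
    ((cs.rightInvSeq (alternatingWord i j (2 * M i j))).count t : ZMod 2) = 0 := by
  rw [← reverse_alternatingWord_two_mul, rightInvSeq_reverse, List.count_reverse]
  set l := cs.leftInvSeq (alternatingWord j i (2 * M i j)) with hl
  have hlen : l.length = 2 * M i j := by simp [hl]
  have h : l.take (M i j) = l.drop (M i j) := by
    apply List.ext_getElem
    · simp [hlen]; omega
    · intro k h1 h2
      simp only [List.length_take, List.length_drop, hlen] at h1 h2
      rw [List.getElem_take, List.getElem_drop]
      rw [getElem_leftInvSeq_alternatingWord _ _ _ _ _ (by omega),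
        getElem_leftInvSeq_alternatingWord _ _ _ _ _ (by omega),
        prod_alternatingWord_eq_mul_pow, prod_alternatingWord_eq_mul_pow,
        show (2 * (M i j + k) + 1) / 2 = M i j + k by omega,
        show (2 * k + 1) / 2 = k by omega, pow_add, simple_mul_simple_pow, one_mul]
      simp
  rw [← List.take_append_drop (M i j) l, List.count_append, ← h, Nat.cast_add]
  exact CharTwo.add_self_eq_zero _

theorem prod_map_alternatingWord_two_mul {A : Type*} [Monoid A] (f : B → A) (i j : B) (m : ℕ) :
    ((alternatingWord i j (2 * m)).map f).prod = (f i * f j) ^ m := by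
  induction m with
  | zero => simp [alternatingWord]
  | succ m ih =>
    rw [mul_add, mul_one, HeckeZero.alternatingWord_map_prod_succ,
      HeckeZero.alternatingWord_map_prod_succ, ih, pow_succ, mul_assoc]

theorem isLiftable_reflectionPerm : M.IsLiftable cs.reflectionPerm := by
  intro i j
  rw [← prod_map_alternatingWord_two_mul]
  ext1 ⟨t, ε⟩
  rw [prod_reflectionPerm_apply, count_rightInvSeq_alternatingWord, wordProd,
    prod_map_alternatingWord_two_mul, simple_mul_simple_pow]
  simp

/-- The action of `W` on `W × ℤ/2` extending `reflectionPerm`. -/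
noncomputable def reflectionAction : W →* Equiv.Perm (W × ZMod 2) :=
  cs.lift ⟨cs.reflectionPerm, cs.isLiftable_reflectionPerm⟩

/-- The parity of the number of occurrences of `t` in the right inversion sequence of any word
for `w`. -/
noncomputable def inversionParity (w t : W) : ZMod 2 := (cs.reflectionAction w (t, 0)).2

open Classical in
theorem reflectionAction_wordProd (ω : List B) (t : W) (ε : ZMod 2) :
    cs.reflectionAction (cs.wordProd ω) (t, ε) =
      (cs.wordProd ω * t * (cs.wordProd ω)⁻¹, ε + ((cs.rightInvSeq ω).count t : ZMod 2)) := by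
  rw [← prod_reflectionPerm_apply]
  congr 1
  rw [wordProd, map_list_prod, List.map_map]
  congr 2
  funext i
  exact cs.lift_apply_simple cs.isLiftable_reflectionPerm i

open Classical in
theorem inversionParity_wordProd (ω : List B) (t : W) :
    cs.inversionParity (cs.wordProd ω) t = ((cs.rightInvSeq ω).count t : ZMod 2) := by
  rw [inversionParity, reflectionAction_wordProd, zero_add]

theorem reflectionAction_apply (w t : W) (ε : ZMod 2) :
    cs.reflectionAction w (t, ε) = (w * t * w⁻¹, ε + cs.inversionParity w t) := by
  classical
  obtain ⟨ω, rfl⟩ := cs.wordProd_surjective w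
  rw [reflectionAction_wordProd, inversionParity_wordProd]

/-- The cocycle rule: the parity is the second coordinate of a group action. -/
theorem inversionParity_mul (u w t : W) :
    cs.inversionParity (u * w) t =
      cs.inversionParity w t + cs.inversionParity u (w * t * w⁻¹) := by
  rw [inversionParity, map_mul, Equiv.Perm.mul_apply, reflectionAction_apply,
    reflectionAction_apply, zero_add]

theorem inversionParity_one (t : W) : cs.inversionParity 1 t = 0 := by
  simp [inversionParity]

theorem inversionParity_simple (i : B) : cs.inversionParity (cs.simple i) (cs.simple i) = 1 := by
  classical
  have h := cs.inversionParity_wordProd [i] (cs.simple i)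
  simpa using h

theorem IsReflection.inversionParity_self {cs : CoxeterSystem M W} {t : W}
    (ht : cs.IsReflection t) : cs.inversionParity t t = 1 := by
  obtain ⟨u, i, rfl⟩ := ht
  -- The contributions of `u` and `u⁻¹` cancel because `u * u⁻¹ = 1`; only that of the simple
  -- reflection in the middle survives.
  have h := cs.inversionParity_mul u u⁻¹ (u * cs.simple i * u⁻¹)
  rw [mul_inv_cancel, inversionParity_one] at h
  rw [inversionParity_mul, inversionParity_mul]
  have e : u⁻¹ * (u * cs.simple i * u⁻¹) * u⁻¹⁻¹ = cs.simple i := by group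
  rw [e] at h ⊢
  rw [mul_inv_cancel_right, inversionParity_simple, add_left_comm, ← h, add_zero]

theorem length_mul_lt_of_inversionParity {w t : W} (h : cs.inversionParity w t = 1) :
    cs.length (w * t) < cs.length w := by
  classical
  obtain ⟨ω, hω, rfl⟩ := cs.exists_isReduced w
  rw [inversionParity_wordProd] at h
  have hm : t ∈ cs.rightInvSeq ω := by
    by_contra hm
    rw [List.count_eq_zero_of_not_mem hm] at h
    exact zero_ne_one (by exact_mod_cast h)
  exact (cs.isRightInversion_of_mem_rightInvSeq hω hm).2

/-- Multiplying by `t` flips the parity at `t`. If `w` has parity `0` then `w * t` has parity `1`,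
so `w * t * t = w` is shorter than `w * t`. -/
theorem IsReflection.length_mul_lt_iff {cs : CoxeterSystem M W} {t : W} (ht : cs.IsReflection t)
    (w : W) : cs.length (w * t) < cs.length w ↔ cs.inversionParity w t = 1 := by
  refine ⟨fun h => ?_, cs.length_mul_lt_of_inversionParity⟩
  by_contra h1
  have h0 : cs.inversionParity w t = 0 := by
    generalize cs.inversionParity w t = x at h1
    revert x
    decide
  have h2 := cs.length_mul_lt_of_inversionParity (w := w * t) (t := t) (by
    rw [inversionParity_mul, ht.inversionParity_self, mul_inv_cancel_right, h0, add_zero])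
  rw [mul_assoc, ht.mul_self, mul_one] at h2
  omega

/-- The exchange property. -/
theorem exists_eraseIdx_of_length_mul_lt {ω : List B} {t : W} (ht : cs.IsReflection t)
    (h : cs.length (cs.wordProd ω * t) < cs.length (cs.wordProd ω)) :
    ∃ p < ω.length, cs.wordProd ω * t = cs.wordProd (ω.eraseIdx p) := by
  classical
  rw [ht.length_mul_lt_iff, inversionParity_wordProd] at h
  have hm : t ∈ cs.rightInvSeq ω := by
    by_contra hm
    rw [List.count_eq_zero_of_not_mem hm] at h
    exact zero_ne_one (by exact_mod_cast h)
  obtain ⟨p, hp, rfl⟩ := List.getElem_of_mem hm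
  refine ⟨p, by simpa using hp, ?_⟩
  rw [← wordProd_mul_getD_rightInvSeq, List.getD_eq_getElem _ _ hp]

/-- The deletion property. -/
theorem exists_reduced_sublist (ω : List B) :
    ∃ ω' : List B, ω'.Sublist ω ∧ cs.IsReduced ω' ∧ cs.wordProd ω' = cs.wordProd ω := by
  induction ω using List.reverseRecOn with
  | nil => exact ⟨[], List.Sublist.refl _, by simp [IsReduced], rfl⟩
  | append_singleton ω i ih =>
    obtain ⟨τ, hsub, hred, hprod⟩ := ih
    rcases cs.length_mul_simple (cs.wordProd τ) i with h | h
    · refine ⟨τ ++ [i], hsub.append_right _, ?_, ?_⟩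
      · simp [IsReduced, wordProd_append, h, hred.eq]
      · simp [wordProd_append, hprod]
    · obtain ⟨p, hp, he⟩ := cs.exists_eraseIdx_of_length_mul_lt (cs.isReflection_simple i)
        (ω := τ) (by omega)
      refine ⟨τ.eraseIdx p, ((List.eraseIdx_sublist _ _).trans hsub).trans
        (List.sublist_append_left _ _), ?_, ?_⟩
      · rw [IsReduced, ← he, List.length_eraseIdx_of_lt hp, ← hred.eq]
        omega
      · rw [← he, hprod, wordProd_append, wordProd_singleton]

theorem exists_reducedWord_of_mem_parabolic {I : Set B} {w : W} (hw : w ∈ cs.parabolic I) :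
    ∃ ω : List B, (∀ i ∈ ω, i ∈ I) ∧ cs.IsReduced ω ∧ cs.wordProd ω = w := by
  have h : ∃ ω : List B, (∀ i ∈ ω, i ∈ I) ∧ cs.wordProd ω = w := by
    refine Subgroup.closure_induction (p := fun w _ => ∃ ω : List B, (∀ i ∈ ω, i ∈ I) ∧
      cs.wordProd ω = w) ?_ ⟨[], by simp, by simp⟩ ?_ ?_ hw
    · rintro _ ⟨i, hi, rfl⟩
      exact ⟨[i], by simpa using hi, by simp⟩
    · rintro _ _ _ _ ⟨ω, h1, rfl⟩ ⟨τ, h2, rfl⟩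
      refine ⟨ω ++ τ, fun i hi => ?_, by simp [wordProd_append]⟩
      exact (List.mem_append.mp hi).elim (h1 i) (h2 i)
    · rintro _ _ ⟨ω, h1, rfl⟩
      exact ⟨ω.reverse, fun i hi => h1 i (List.mem_reverse.mp hi), by simp⟩
  obtain ⟨ω, hI, rfl⟩ := h
  obtain ⟨τ, hsub, hred, hprod⟩ := cs.exists_reduced_sublist ω
  exact ⟨τ, fun i hi => hI i (hsub.subset hi), hred, hprod⟩

theorem parabolic_univ : cs.parabolic Set.univ = ⊤ := by
  rw [parabolic, Set.image_univ, subgroup_closure_range_simple]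

theorem simple_mem_parabolic {I : Set B} {i : B} (hi : i ∈ I) : cs.simple i ∈ cs.parabolic I :=
  Subgroup.subset_closure ⟨i, hi, rfl⟩

section Longest

variable [Finite W]

theorem longest_mem (I : Set B) : cs.longest I ∈ cs.parabolic I :=
  (cs.exists_longest I).choose_spec.1

theorem length_le_longest {I : Set B} {v : W} (hv : v ∈ cs.parabolic I) :
    cs.length v ≤ cs.length (cs.longest I) :=
  (cs.exists_longest I).choose_spec.2 v hv

theorem length_le_longest_univ (v : W) : cs.length v ≤ cs.length (cs.longest Set.univ) :=
  cs.length_le_longest (by rw [parabolic_univ]; trivial)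

theorem length_longest_mul_simple {I : Set B} {i : B} (hi : i ∈ I) :
    cs.length (cs.longest I * cs.simple i) + 1 = cs.length (cs.longest I) := by
  have h := cs.length_le_longest
    ((cs.parabolic I).mul_mem (cs.longest_mem I) (cs.simple_mem_parabolic hi))
  rcases cs.length_mul_simple (cs.longest I) i with h' | h' <;> omega

theorem length_simple_mul_longest {I : Set B} {i : B} (hi : i ∈ I) :
    cs.length (cs.simple i * cs.longest I) + 1 = cs.length (cs.longest I) := by
  have h := cs.length_le_longest
    ((cs.parabolic I).mul_mem (cs.simple_mem_parabolic hi) (cs.longest_mem I))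
  rcases cs.length_simple_mul (cs.longest I) i with h' | h' <;> omega

theorem IsReflection.inversionParity_longest {cs : CoxeterSystem M W} {t : W}
    (ht : cs.IsReflection t) : cs.inversionParity (cs.longest Set.univ) t = 1 := by
  rw [← ht.length_mul_lt_iff]
  exact lt_of_le_of_ne (cs.length_le_longest_univ _) (ht.length_mul_left_ne _)

/-- Every reflection is an inversion of `w₀`, so the cocycle rule makes the parities of `w₀ w` and
`w` opposite at each simple reflection. A letter that lengthens `w` therefore shortens `w₀ w`. -/
theorem length_longest_mul_add (w : W) :
    cs.length (cs.longest Set.univ * w) + cs.length w = cs.length (cs.longest Set.univ) := by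
  obtain ⟨ω, hω, rfl⟩ := cs.exists_isReduced w
  induction ω using List.reverseRecOn with
  | nil => simp
  | append_singleton ω i ih =>
    have hω' : cs.IsReduced ω := by simpa using hω.take ω.length
    have ih := ih hω'
    have hl : cs.length (cs.wordProd ω * cs.simple i) = cs.length (cs.wordProd ω) + 1 := by
      have := hω.eq
      rw [wordProd_append, wordProd_singleton] at this
      rw [this, hω'.eq]
      simp
    have hi := cs.isReflection_simple i
    have h0 : cs.inversionParity (cs.wordProd ω) (cs.simple i) ≠ 1 := by
      rw [Ne, ← hi.length_mul_lt_iff]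
      omega
    have h1 : cs.inversionParity (cs.longest Set.univ * cs.wordProd ω) (cs.simple i) = 1 := by
      rw [inversionParity_mul, (hi.conj _).inversionParity_longest]
      generalize cs.inversionParity (cs.wordProd ω) (cs.simple i) = x at h0
      revert x
      decide
    rw [← hi.length_mul_lt_iff] at h1
    rw [wordProd_append, wordProd_singleton, hl, ← mul_assoc]
    rcases cs.length_mul_simple (cs.longest Set.univ * cs.wordProd ω) i with h | h <;> omega

theorem longest_mul_longest : cs.longest Set.univ * cs.longest Set.univ = 1 := by
  rw [← cs.length_eq_zero_iff]
  have := cs.length_longest_mul_add (cs.longest Set.univ)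
  omega

theorem length_longest_conj (w : W) :
    cs.length (cs.longest Set.univ * w * cs.longest Set.univ) = cs.length w := by
  have hinv : (cs.longest Set.univ)⁻¹ = cs.longest Set.univ :=
    inv_eq_of_mul_eq_one_left cs.longest_mul_longest
  have h1 := cs.length_longest_mul_add (w * cs.longest Set.univ)
  have h2 := cs.length_longest_mul_add w⁻¹
  rw [← cs.length_inv (w * _), mul_inv_rev, hinv, ← mul_assoc] at h1
  rw [cs.length_inv w] at h2
  omega

end Longest

end CoxeterSystem

/-! ### The order of a product of two reflections -/

namespace Module

open Polynomial.Chebyshev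

variable {V : Type*} [AddCommGroup V] [Module ℝ V] {x y : V} {f g : Dual ℝ V}

theorem sin_two_pi_div_ne_zero {m : ℕ} (hm : 3 ≤ m) : Real.sin (2 * Real.pi / m) ≠ 0 := by
  have hm' : (3 : ℝ) ≤ m := by exact_mod_cast hm
  refine (Real.sin_pos_of_pos_of_lt_pi (by positivity) ?_).ne'
  rw [div_lt_iff₀ (by linarith)]
  nlinarith [Real.pi_pos]

theorem four_mul_cos_sq_sub_two {m : ℕ} :
    -2 * Real.cos (Real.pi / m) * (-2 * Real.cos (Real.pi / m)) - 2 =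
      2 * Real.cos (2 * Real.pi / m) := by
  rw [mul_div_assoc, Real.cos_two_mul]
  ring

/-- The powers have coefficients `S_n(2 cos θ)` with `θ = 2π / m`, and `S_n(2 cos θ) sin θ = sin ((n
+ 1) θ)`. The relevant coefficients vanish since `m θ = 2π`. For `m = 2` the factor `sin θ` is zero,
but then the reflections commute. -/
theorem reflection_mul_reflection_pow_eq_one (hf : f x = 2) (hg : g y = 2) {m : ℕ} (hm : 2 ≤ m)
    (hfy : f y = -2 * Real.cos (Real.pi / m)) (hgx : g x = -2 * Real.cos (Real.pi / m)) :
    (reflection hf * reflection hg) ^ m = 1 := by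
  ext z
  rw [LinearEquiv.coe_one, id]
  rcases hm.lt_or_eq with hm | rfl
  · have hs := sin_two_pi_div_ne_zero hm
    have hm0 : (m : ℝ) ≠ 0 := by positivity
    have ht : 2 * Real.cos (2 * Real.pi / m) = f y * g x - 2 := by
      rw [hfy, hgx, four_mul_cos_sq_sub_two]
    rw [reflection_mul_reflection_pow_apply hf hg m z _ ht]
    set t := 2 * Real.cos (2 * Real.pi / m) with htdef
    have hS (n : ℤ) : (S ℝ n).eval t * Real.sin (2 * Real.pi / m) =
        Real.sin ((n + 1) * (2 * Real.pi / m)) := S_two_mul_real_cos _ n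
    rcases Nat.even_or_odd' m with ⟨k, hk | hk⟩
    · have h0 : (S ℝ ((k : ℤ) - 1)).eval t = 0 := by
        have := hS (k - 1)
        rw [show (((k : ℤ) - 1 : ℤ) + 1 : ℝ) * (2 * Real.pi / m) = Real.pi by
          have h1 : (m : ℝ) = 2 * k := by exact_mod_cast hk
          rw [h1] at hm0 ⊢
          have : (k : ℝ) ≠ 0 := by simpa using hm0
          push_cast
          field_simp
          ring, Real.sin_pi] at this
        exact (mul_eq_zero.mp this).resolve_right hs
      rw [show ((m : ℤ) - 2) / 2 = k - 1 by omega, show ((m : ℤ) - 1) / 2 = k - 1 by omega, h0]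
      simp
    · have h0 : (S ℝ k).eval t + (S ℝ ((k : ℤ) - 1)).eval t = 0 := by
        have := congrArg₂ (· + ·) (hS k) (hS (k - 1))
        simp only [← add_mul] at this
        have e : (((k : ℤ) : ℝ) + 1) * (2 * Real.pi / m) =
            2 * Real.pi - (((k : ℤ) - 1 : ℤ) + 1 : ℝ) * (2 * Real.pi / m) := by
          have h1 : (m : ℝ) = 2 * k + 1 := by exact_mod_cast hk
          rw [h1] at hm0 ⊢
          push_cast
          field_simp
          ring
        rw [e, Real.sin_two_pi_sub, neg_add_cancel] at this
        exact (mul_eq_zero.mp this).resolve_right hs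
      rw [show ((m : ℤ) - 2) / 2 = k - 1 by omega, show ((m : ℤ) - 1) / 2 = k by omega,
        show ((m : ℤ) - 3) / 2 = k - 1 by omega, show (m : ℤ) / 2 = k by omega, h0]
      simp
  · norm_num at hfy hgx
    simp only [pow_two, LinearEquiv.mul_apply, reflection_apply, map_sub, map_smul, hf, hg, hfy,
      hgx]
    module

theorem dvd_of_reflection_mul_reflection_pow_eq_one (hf : f x = 2) (hg : g y = 2)
    (hxy : LinearIndependent ℝ ![x, y]) {m : ℕ} (hm : 2 ≤ m)
    (hfy : f y = -2 * Real.cos (Real.pi / m)) (hgx : g x = -2 * Real.cos (Real.pi / m)) {n : ℕ}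
    (h : (reflection hf * reflection hg) ^ n = 1) : m ∣ n := by
  have h1 := congrArg (· x) h
  simp only [LinearEquiv.coe_one, id] at h1
  rcases hm.lt_or_eq with hm | rfl
  · have hs := sin_two_pi_div_ne_zero hm
    have hm0 : (m : ℝ) ≠ 0 := by positivity
    have ht : 2 * Real.cos (2 * Real.pi / m) = f y * g x - 2 := by
      rw [hfy, hgx, four_mul_cos_sq_sub_two]
    rw [reflection_mul_reflection_pow_apply_self hf hg n _ ht] at h1
    have hS (n : ℤ) : (S ℝ n).eval (2 * Real.cos (2 * Real.pi / m)) * Real.sin (2 * Real.pi / m) =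
        Real.sin ((n + 1) * (2 * Real.pi / m)) := S_two_mul_real_cos _ n
    set t := 2 * Real.cos (2 * Real.pi / m) with htdef
    -- Comparing coefficients of `x` and `y` gives `S_{n-1} = 0` and `S_n = 1`, that is `sin (n θ) =
    -- 0` and `cos (n θ) = 1`.
    have h2 := LinearIndependent.pair_iff.mp hxy
      ((S ℝ n).eval t + (S ℝ ((n : ℤ) - 1)).eval t - 1) ((S ℝ ((n : ℤ) - 1)).eval t * -g x) (by
        rw [sub_smul, one_smul, sub_add_eq_add_sub, h1, sub_self])
    have hgx0 : -g x ≠ 0 := by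
      rw [hgx]
      have : 0 < Real.cos (Real.pi / m) := by
        apply Real.cos_pos_of_mem_Ioo
        have hm' : (3 : ℝ) ≤ m := by exact_mod_cast hm
        constructor
        · have : 0 < Real.pi / m := by positivity
          linarith [Real.pi_pos]
        · rw [div_lt_div_iff₀ (by linarith) (by norm_num)]
          nlinarith [Real.pi_pos]
      simp [this.ne']
    have h3 := (mul_eq_zero.mp h2.2).resolve_right hgx0
    have h4 : (S ℝ n).eval t = 1 := by linarith [h2.1]
    have h5 := hS (n - 1)
    rw [h3, zero_mul] at h5
    have h6 := hS n
    rw [h4, one_mul] at h6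
    push_cast at h5 h6
    rw [sub_add_cancel] at h5
    rw [add_mul, one_mul, Real.sin_add, ← h5, zero_mul, zero_add] at h6
    have h7 : Real.cos (n * (2 * Real.pi / m)) = 1 := by
      have : (Real.cos (n * (2 * Real.pi / m)) - 1) * Real.sin (2 * Real.pi / m) = 0 := by
        linarith
      linarith [(mul_eq_zero.mp this).resolve_right hs]
    obtain ⟨k, hk⟩ := (Real.cos_eq_one_iff _).mp h7
    have h8 : (n : ℝ) = k * m := by
      have hpi := Real.pi_ne_zero
      field_simp at hk
      linarith
    have h9 : (n : ℤ) = k * m := by exact_mod_cast h8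
    exact Int.natCast_dvd_natCast.mp ⟨k, by rw [h9, mul_comm]⟩
  · norm_num at hfy hgx
    have e : (reflection hf * reflection hg) x = -x := by
      simp [LinearEquiv.mul_apply, reflection_apply, hgx]
    have e' (n : ℕ) : ((reflection hf * reflection hg) ^ n) x = (-1 : ℝ) ^ n • x := by
      induction n with
      | zero => simp
      | succ n ih => rw [pow_succ, LinearEquiv.mul_apply, e, map_neg, ih, pow_succ]; simp
    rw [e'] at h1
    by_contra hn
    have hn : Odd n := by rwa [← Nat.not_even_iff_odd, even_iff_two_dvd]
    have hx : x ≠ 0 := hxy.ne_zero 0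
    rw [hn.neg_one_pow, neg_smul, one_smul] at h1
    have h2 : (2 : ℝ) • x = 0 := by rw [two_smul, ← neg_add_cancel x, h1]
    exact hx ((smul_eq_zero.mp h2).resolve_left two_ne_zero)

theorem eq_zero_of_reflection_mul_reflection_pow_eq_one (hf : f x = 2) (hg : g y = 2)
    (hxy : LinearIndependent ℝ ![x, y]) (hfy : f y = -2) (hgx : g x = -2) {n : ℕ}
    (h : (reflection hf * reflection hg) ^ n = 1) : n = 0 := by
  have h1 := congrArg (· x) h
  simp only [LinearEquiv.coe_one, id] at h1
  -- Here the Chebyshev argument is `2` and `S_n(2) = n + 1`, so the coefficient of `y` is `2n`.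
  rw [reflection_mul_reflection_pow_apply_self hf hg n 2 (by rw [hfy, hgx]; norm_num),
    S_eval_two, S_eval_two, hgx] at h1
  have h2 := LinearIndependent.pair_iff.mp hxy _ _ (show
      ((((n : ℤ) : ℝ) + 1 + ((((n : ℤ) - 1 : ℤ) : ℝ) + 1)) - 1) • x +
        (((((n : ℤ) - 1 : ℤ) : ℝ) + 1) * - -2) • y = 0 by
    rw [sub_smul, one_smul, sub_add_eq_add_sub, h1, sub_self])
  have h3 := h2.2
  push_cast at h3
  have : (n : ℝ) = 0 := by linarith
  exact_mod_cast this

end Module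

/-! ### The geometric representation and the order of `s_i s_j` -/

namespace CoxeterSystem

variable {B W : Type*} [Group W] {M : CoxeterMatrix B} (cs : CoxeterSystem M W)

/-- The coefficient `2 ⟨α_i, α_j⟩` of the canonical bilinear form. -/
noncomputable def rootPairing (M : CoxeterMatrix B) (i j : B) : ℝ :=
  if M i j = 0 then -2 else -2 * Real.cos (Real.pi / M i j)

theorem linearCombination_rootPairing_self (M : CoxeterMatrix B) (i : B) :
    Finsupp.linearCombination ℝ (rootPairing M i) (Finsupp.single i 1) = 2 := by
  simp [rootPairing]

/-- The reflection in the simple root `α_i`. -/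
noncomputable def simpleReflection (M : CoxeterMatrix B) (i : B) : (B →₀ ℝ) ≃ₗ[ℝ] (B →₀ ℝ) :=
  Module.reflection (linearCombination_rootPairing_self M i)

theorem isLiftable_simpleReflection : M.IsLiftable (simpleReflection M) := by
  intro i j
  by_cases hij : i = j
  · subst hij
    rw [M.diagonal, pow_one]
    refine LinearEquiv.ext fun z => ?_
    rw [LinearEquiv.mul_apply, LinearEquiv.coe_one, id]
    exact Module.involutive_reflection (linearCombination_rootPairing_self M i) z
  by_cases h0 : M i j = 0
  · rw [h0, pow_zero]
  have h1 := M.off_diagonal i j hij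
  refine Module.reflection_mul_reflection_pow_eq_one _ _ (by omega) ?_ ?_
  · simp [rootPairing, h0]
  · simp [rootPairing, h0, M.symmetric j i]

/-- The geometric representation. -/
noncomputable def geometricRep : W →* ((B →₀ ℝ) ≃ₗ[ℝ] (B →₀ ℝ)) :=
  cs.lift ⟨simpleReflection M, isLiftable_simpleReflection⟩

theorem dvd_of_simple_mul_simple_pow_eq_one {i j : B} {n : ℕ}
    (h : (cs.simple i * cs.simple j) ^ n = 1) : M i j ∣ n := by
  by_cases hij : i = j
  · subst hij
    simp
  have hx : LinearIndependent ℝ ![(Finsupp.single i 1 : B →₀ ℝ), Finsupp.single j 1] := by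
    rw [LinearIndependent.pair_iff]
    intro s t h
    have hi := DFunLike.congr_fun h i
    have hj := DFunLike.congr_fun h j
    simpa [Finsupp.single_apply, hij, Ne.symm hij, eq_comm] using And.intro hi hj
  have hr := congrArg cs.geometricRep h
  have hs (k : B) : cs.geometricRep (cs.simple k) = simpleReflection M k :=
    cs.lift_apply_simple isLiftable_simpleReflection k
  rw [map_pow, map_mul, map_one, hs, hs] at hr
  by_cases h0 : M i j = 0
  · rw [Module.eq_zero_of_reflection_mul_reflection_pow_eq_one _ _ hx _ _ hr]
    · simp
    · simp [rootPairing, h0]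
    · simp [rootPairing, h0, M.symmetric j i]
  have h1 := M.off_diagonal i j hij
  refine Module.dvd_of_reflection_mul_reflection_pow_eq_one _ _ hx (by omega) ?_ ?_ hr
  · simp [rootPairing, h0]
  · simp [rootPairing, h0, M.symmetric j i]

theorem orderOf_simple_mul_simple (i j : B) : orderOf (cs.simple i * cs.simple j) = M i j :=
  Nat.dvd_antisymm (orderOf_dvd_of_pow_eq_one (cs.simple_mul_simple_pow i j))
    (cs.dvd_of_simple_mul_simple_pow_eq_one (pow_orderOf_eq_one _))

theorem simple_injective : Function.Injective cs.simple := by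
  intro i j h
  by_contra hij
  apply M.off_diagonal i j hij
  rw [← cs.orderOf_simple_mul_simple, h, simple_mul_simple_self, orderOf_one]

end CoxeterSystem

/-! ### Matsumoto's theorem and products along reduced words -/

namespace CoxeterSystem

variable {B W : Type*} [Group W] {M : CoxeterMatrix B} (cs : CoxeterSystem M W)

/-- `f` satisfies the braid relations of `M`. -/
def IsBraided {A : Type*} [Monoid A] (M : CoxeterMatrix B) (f : B → A) : Prop :=
  ∀ i j, ((alternatingWord i j (M i j)).map f).prod = ((alternatingWord j i (M i j)).map f).prod

theorem IsReduced.of_append_left {cs : CoxeterSystem M W} {ω τ : List B}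
    (h : cs.IsReduced (ω ++ τ)) : cs.IsReduced ω := by
  simpa using h.take ω.length

theorem IsReduced.of_append_right {cs : CoxeterSystem M W} {ω τ : List B}
    (h : cs.IsReduced (ω ++ τ)) : cs.IsReduced τ := by
  simpa using h.drop ω.length

/-- Equality of the two products says `(s_i s_j) ^ n = 1`, so `m_ij` divides `n`; an alternating
word longer than `m_ij ≠ 0` is not reduced. -/
theorem eq_coxeterMatrix_of_wordProd_alternatingWord_eq {i j : B} {n : ℕ} (hn : 0 < n)
    (hred : cs.IsReduced (alternatingWord i j n))
    (h : cs.wordProd (alternatingWord i j n) = cs.wordProd (alternatingWord j i n)) :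
    n = M i j := by
  have hdvd : M i j ∣ n := by
    apply cs.dvd_of_simple_mul_simple_pow_eq_one
    have hinv : cs.simple j * cs.simple i = (cs.simple i * cs.simple j)⁻¹ := by simp
    rw [prod_alternatingWord_eq_mul_pow, prod_alternatingWord_eq_mul_pow, hinv] at h
    rcases Nat.even_or_odd' n with ⟨k, rfl | rfl⟩
    · rw [show 2 * k / 2 = k by omega, inv_pow] at h
      simp only [even_two, Even.mul_right, ↓reduceIte, one_mul] at h
      rw [two_mul, pow_add]
      nth_rw 1 [h]
      exact inv_mul_cancel _
    · rw [show (2 * k + 1) / 2 = k by omega, inv_pow,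
        if_neg (by simp), if_neg (by simp)] at h
      have h' := congrArg (cs.simple i * ·) h
      simp only [← mul_assoc, simple_mul_simple_self, one_mul] at h'
      rw [← pow_succ'] at h'
      rw [two_mul, add_assoc, pow_add, h', mul_inv_cancel]
  have h0 : M i j ≠ 0 := by
    rintro h0
    rw [h0, zero_dvd_iff] at hdvd
    omega
  refine le_antisymm ?_ (Nat.le_of_dvd hn hdvd)
  by_contra hlt
  exact cs.not_isReduced_alternatingWord i j h0 (by omega) hred

theorem IsReduced.length_eq {cs : CoxeterSystem M W} {ω τ : List B} (hω : cs.IsReduced ω)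
    (hτ : cs.IsReduced τ) (h : cs.wordProd ω = cs.wordProd τ) : ω.length = τ.length := by
  rw [← hω.eq, h, hτ.eq]

/-- Matsumoto's theorem. -/
theorem IsBraided.prod_eq {A : Type*} [Monoid A] {f : B → A} (hf : IsBraided M f) {ω τ : List B}
    (hω : cs.IsReduced ω) (hτ : cs.IsReduced τ) (h : cs.wordProd ω = cs.wordProd τ) :
    (ω.map f).prod = (τ.map f).prod := by
  induction hn : ω.length generalizing ω τ with
  | zero =>
    have hl := hω.length_eq hτ h
    rw [hn] at hl
    rw [List.length_eq_zero_iff.mp hn, List.length_eq_zero_iff.mp hl.symm]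
  | succ n ih =>
    -- By induction on length, two reduced words for one element that share a last (or first) letter
    -- have equal products.
    have hlast (x y : List B) (b : B) (hx : cs.IsReduced (x ++ [b])) (hy : cs.IsReduced (y ++ [b]))
        (hxy : cs.wordProd (x ++ [b]) = cs.wordProd (y ++ [b])) (hl : (x ++ [b]).length = n + 1) :
        ((x ++ [b]).map f).prod = ((y ++ [b]).map f).prod := by
      rw [List.map_append, List.map_append, List.prod_append, List.prod_append,
        ih hx.of_append_left hy.of_append_left (by simpa [wordProd_append] using hxy)
          (by simpa using hl)]
    have hfirst (x y : List B) (b : B) (hx : cs.IsReduced (b :: x)) (hy : cs.IsReduced (b :: y))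
        (hxy : cs.wordProd (b :: x) = cs.wordProd (b :: y)) (hl : (b :: x).length = n + 1) :
        ((b :: x).map f).prod = ((b :: y).map f).prod := by
      rw [List.map_cons, List.map_cons, List.prod_cons, List.prod_cons,
        ih (hx.of_append_right (ω := [b])) (hy.of_append_right (ω := [b]))
          (by simpa [wordProd_cons] using hxy) (by simpa using hl)]
    by_contra hne
    -- Exchange deletes a letter of `x` and appends `b`. The new word has the same product as `r ++
    -- [b]`, as they share the last letter. If the deleted letter were not the first, it would also
    -- agree with `x`, against `hne`. So the first letter goes, and `x` with the new word is again a
    -- counterexample.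
    have hstep (x r : List B) (b : B) (hx : cs.IsReduced x) (hy : cs.IsReduced (r ++ [b]))
        (hxy : cs.wordProd x = cs.wordProd (r ++ [b])) (hl : x.length = n + 1)
        (hne : (x.map f).prod ≠ ((r ++ [b]).map f).prod) :
        cs.IsReduced (x.tail ++ [b]) ∧ cs.wordProd x = cs.wordProd (x.tail ++ [b]) ∧
          (x.map f).prod ≠ ((x.tail ++ [b]).map f).prod := by
      have hdesc : cs.length (cs.wordProd x * cs.simple b) < cs.length (cs.wordProd x) := by
        rw [hxy, hy.eq, wordProd_append, wordProd_singleton, simple_mul_simple_cancel_right,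
          hy.of_append_left.eq]
        simp
      obtain ⟨p, hp, he⟩ := cs.exists_eraseIdx_of_length_mul_lt (cs.isReflection_simple b) hdesc
      have hprod : cs.wordProd x = cs.wordProd (x.eraseIdx p ++ [b]) := by
        rw [wordProd_append, ← he, wordProd_singleton, simple_mul_simple_cancel_right]
      have hred : cs.IsReduced (x.eraseIdx p ++ [b]) := by
        rw [IsReduced, ← hprod, hx.eq, List.length_append, List.length_eraseIdx_of_lt hp,
          List.length_singleton]
        omega
      have hfy := hlast _ _ _ hred hy (hprod.symm.trans hxy) (by
        rw [hred.length_eq hx hprod.symm, hl])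
      obtain _ | ⟨c, x⟩ := x
      · simp at hl
      rcases p with _ | p
      · exact ⟨hred, hprod, fun h => hne (h.trans hfy)⟩
      · exact absurd ((hfirst _ _ _ hx hred hprod hl).trans hfy) hne
    -- Each use of `hstep` lengthens the alternating tail by one, until the whole word alternates
    -- and the braid relation applies.
    have hclaim (k : ℕ) (hk : k ≤ n) : ∃ (a b : B) (r r' : List B),
        cs.IsReduced (r ++ alternatingWord b a (k + 1)) ∧ cs.IsReduced (r' ++ [b]) ∧
        cs.wordProd (r ++ alternatingWord b a (k + 1)) = cs.wordProd (r' ++ [b]) ∧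
        (r ++ alternatingWord b a (k + 1)).length = n + 1 ∧
        ((r ++ alternatingWord b a (k + 1)).map f).prod ≠ ((r' ++ [b]).map f).prod := by
      induction k with
      | zero =>
        rcases List.eq_nil_or_concat ω with rfl | ⟨r, a, rfl⟩
        · simp at hn
        rcases List.eq_nil_or_concat τ with rfl | ⟨r', b, rfl⟩
        · have := hω.length_eq hτ h
          rw [hn] at this
          simp at this
        exact ⟨a, b, r, r', by simpa [alternatingWord] using hω, by simpa using hτ,
          by simpa [alternatingWord] using h, by simpa [alternatingWord] using hn,
          by simpa [alternatingWord] using hne⟩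
      | succ k ihk =>
        obtain ⟨a, b, r, r', hx, hy, hxy, hl, hne⟩ := ihk (by omega)
        obtain ⟨h1, h2, h3⟩ := hstep _ _ _ hx hy hxy hl hne
        obtain _ | ⟨c, r⟩ := r
        · simp at hl
          omega
        have e : (c :: r ++ alternatingWord b a (k + 1)).tail ++ [b] =
            r ++ alternatingWord a b (k + 1 + 1) := by
          rw [alternatingWord_succ a b (k + 1)]
          simp
        have e' : c :: r ++ alternatingWord b a (k + 1) = (c :: r ++ alternatingWord a b k) ++ [a] := by
          rw [alternatingWord_succ b a k]
          simp
        rw [e] at h1 h2 h3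
        rw [e'] at hx h2 h3 hl
        refine ⟨b, a, r, _, h1, hx, h2.symm, ?_, h3.symm⟩
        rw [← hl, hx.length_eq h1 h2]
    obtain ⟨a, b, r, r', hx, hy, hxy, hl, hne⟩ := hclaim n le_rfl
    have hr : r = [] := by
      rw [List.length_append, length_alternatingWord] at hl
      exact List.length_eq_zero_iff.mp (by omega)
    subst hr
    rw [List.nil_append] at hx hxy hl hne
    obtain ⟨h1, h2, h3⟩ := hstep _ _ _ hx hy hxy hl hne
    have e : (alternatingWord b a (n + 1)).tail ++ [b] = alternatingWord a b (n + 1) := by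
      rw [alternatingWord_succ', List.tail_cons, alternatingWord_succ a b, List.concat_eq_append]
    rw [e] at h2 h3
    rw [cs.eq_coxeterMatrix_of_wordProd_alternatingWord_eq (Nat.add_one_pos n) hx h2] at h3
    exact h3 (hf b a)

section Demazure

variable {A : Type*} [Monoid A] {f : B → A}

/-- The product of `f` along a reduced expression of `w`. -/
noncomputable def reducedProd (f : B → A) (w : W) : A := ((cs.reducedExpr w).map f).prod

theorem IsBraided.reducedProd_wordProd (hf : IsBraided M f) {ω : List B} (hω : cs.IsReduced ω) :
    cs.reducedProd f (cs.wordProd ω) = (ω.map f).prod := by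
  have h := (cs.exists_isReduced (cs.wordProd ω)).choose_spec
  exact hf.prod_eq cs h.1 hω h.2.symm

theorem IsBraided.reducedProd_one (hf : IsBraided M f) : cs.reducedProd f 1 = 1 := by
  simpa using hf.reducedProd_wordProd cs (ω := []) (by simp [IsReduced])

theorem IsBraided.reducedProd_simple (hf : IsBraided M f) (i : B) :
    cs.reducedProd f (cs.simple i) = f i := by
  simpa using hf.reducedProd_wordProd cs (ω := [i]) (by simp [IsReduced])

theorem IsBraided.reducedProd_mul_of_lt (hf : IsBraided M f) {w : W} {i : B}
    (h : cs.length (w * cs.simple i) = cs.length w + 1) :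
    cs.reducedProd f w * f i = cs.reducedProd f (w * cs.simple i) := by
  obtain ⟨ω, hω, rfl⟩ := cs.exists_isReduced w
  have hred : cs.IsReduced (ω ++ [i]) := by
    simp [IsReduced, wordProd_append, h, hω.eq]
  have := hf.reducedProd_wordProd cs hred
  rw [wordProd_append, wordProd_singleton] at this
  rw [this, hf.reducedProd_wordProd cs hω]
  simp

theorem IsBraided.mul_reducedProd_of_lt (hf : IsBraided M f) {w : W} {i : B}
    (h : cs.length (cs.simple i * w) = cs.length w + 1) :
    f i * cs.reducedProd f w = cs.reducedProd f (cs.simple i * w) := by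
  obtain ⟨ω, hω, rfl⟩ := cs.exists_isReduced w
  have hred : cs.IsReduced (i :: ω) := by
    simp [IsReduced, wordProd_cons, h, hω.eq]
  have := hf.reducedProd_wordProd cs hred
  rw [wordProd_cons] at this
  rw [this, hf.reducedProd_wordProd cs hω]
  simp

theorem IsBraided.reducedProd_mul_of_gt (hf : IsBraided M f) (hi : ∀ i, f i * f i = f i) {w : W}
    {i : B} (h : cs.length (w * cs.simple i) + 1 = cs.length w) :
    cs.reducedProd f w * f i = cs.reducedProd f w := by
  have := hf.reducedProd_mul_of_lt cs (w := w * cs.simple i) (i := i) (by simp [h])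
  rw [simple_mul_simple_cancel_right] at this
  rw [← this, mul_assoc, hi]

theorem IsBraided.mul_reducedProd_of_gt (hf : IsBraided M f) (hi : ∀ i, f i * f i = f i) {w : W}
    {i : B} (h : cs.length (cs.simple i * w) + 1 = cs.length w) :
    f i * cs.reducedProd f w = cs.reducedProd f w := by
  have := hf.mul_reducedProd_of_lt cs (w := cs.simple i * w) (i := i) (by simp [h])
  rw [simple_mul_simple_cancel_left] at this
  rw [← this, ← mul_assoc, hi]

variable [Finite W]

/-- The chosen reduced expression is traded for one whose letters visibly lie in `I`. -/
theorem exists_reducedWord_longest (hf : IsBraided M f) (I : Set B) :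
    ∃ ω : List B, (∀ i ∈ ω, i ∈ I) ∧ cs.reducedProd f (cs.longest I) = (ω.map f).prod := by
  obtain ⟨ω, hI, hred, hprod⟩ := cs.exists_reducedWord_of_mem_parabolic (cs.longest_mem I)
  exact ⟨ω, hI, by rw [← hf.reducedProd_wordProd cs hred, hprod]⟩

theorem IsBraided.reducedProd_longest_mul (hf : IsBraided M f) (hi : ∀ i, f i * f i = f i)
    {I : Set B} {i : B} (h : i ∈ I) :
    cs.reducedProd f (cs.longest I) * f i = cs.reducedProd f (cs.longest I) :=
  hf.reducedProd_mul_of_gt cs hi (cs.length_longest_mul_simple h)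

theorem IsBraided.mul_reducedProd_longest (hf : IsBraided M f) (hi : ∀ i, f i * f i = f i)
    {I : Set B} {i : B} (h : i ∈ I) :
    f i * cs.reducedProd f (cs.longest I) = cs.reducedProd f (cs.longest I) :=
  hf.mul_reducedProd_of_gt cs hi (cs.length_simple_mul_longest h)

end Demazure

end CoxeterSystem

/-! ### The length filtration -/

namespace CoxeterSystem

variable {B W : Type*} [Group W] {M : CoxeterMatrix B} (cs : CoxeterSystem M W)

theorem mul_prod_eq_self {A : Type*} [Monoid A] {f : B → A} {I : Set B} {c : A}
    (h : ∀ i ∈ I, c * f i = c) {ω : List B} (hω : ∀ i ∈ ω, i ∈ I) : c * (ω.map f).prod = c := by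
  induction ω with
  | nil => simp
  | cons i ω ih =>
    rw [List.map_cons, List.prod_cons, ← mul_assoc, h i (hω i (by simp)),
      ih fun j hj => hω j (by simp [hj])]

theorem prod_mul_eq_self {A : Type*} [Monoid A] {f : B → A} {I : Set B} {c : A}
    (h : ∀ i ∈ I, f i * c = c) {ω : List B} (hω : ∀ i ∈ ω, i ∈ I) : (ω.map f).prod * c = c := by
  induction ω with
  | nil => simp
  | cons i ω ih =>
    rw [List.map_cons, List.prod_cons, mul_assoc, ih fun j hj => hω j (by simp [hj]),
      h i (hω i (by simp))]

section Filtration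

variable (F : Type*) [Field F] {A : Type*} [Ring A] [Algebra F A] (e : B → A)

/-- The span of the products `e_w` with `ℓ w ≥ k`. -/
def lengthFiltration (k : ℕ) : Submodule F A :=
  Submodule.span F {x | ∃ w, k ≤ cs.length w ∧ cs.reducedProd e w = x}

variable {F e}

theorem reducedProd_mem_lengthFiltration {k : ℕ} {w : W} (h : k ≤ cs.length w) :
    cs.reducedProd e w ∈ cs.lengthFiltration F e k :=
  Submodule.subset_span ⟨w, h, rfl⟩

theorem lengthFiltration_eq_bot [Finite W] {k : ℕ} (h : cs.length (cs.longest Set.univ) < k) :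
    cs.lengthFiltration F e k = ⊥ := by
  rw [lengthFiltration, Submodule.span_eq_bot]
  rintro _ ⟨w, hw, -⟩
  have := cs.length_le_longest_univ w
  omega

variable (hb : IsBraided M e) (hi : ∀ i, e i * e i = e i)
include hb hi

/-- Each letter either lengthens the element or is absorbed. -/
theorem exists_reducedProd_mul_eq (w : W) (ω : List B) :
    ∃ v, cs.length w ≤ cs.length v ∧
      cs.reducedProd e w * (ω.map e).prod = cs.reducedProd e v := by
  induction ω generalizing w with
  | nil => exact ⟨w, le_rfl, by simp⟩
  | cons i ω ih =>
    rw [List.map_cons, List.prod_cons, ← mul_assoc]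
    rcases cs.length_mul_simple w i with h | h
    · obtain ⟨v, h1, h2⟩ := ih (w * cs.simple i)
      exact ⟨v, by omega, by rw [hb.reducedProd_mul_of_lt cs h, h2]⟩
    · obtain ⟨v, h1, h2⟩ := ih w
      exact ⟨v, h1, by rw [hb.reducedProd_mul_of_gt cs hi h, h2]⟩

theorem mul_gen_mem_lengthFiltration {k : ℕ} {x : A} (hx : x ∈ cs.lengthFiltration F e k) (i : B) :
    x * e i ∈ cs.lengthFiltration F e k := by
  induction hx using Submodule.span_induction with
  | mem x hx =>
    obtain ⟨w, hw, rfl⟩ := hx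
    obtain ⟨v, h1, h2⟩ := cs.exists_reducedProd_mul_eq hb hi w [i]
    rw [List.map_singleton, List.prod_singleton] at h2
    rw [h2]
    exact cs.reducedProd_mem_lengthFiltration (hw.trans h1)
  | zero => simp
  | add x y _ _ hx hy => rw [add_mul]; exact add_mem hx hy
  | smul c x _ hx => rw [smul_mul_assoc]; exact Submodule.smul_mem _ c hx

theorem mul_mem_lengthFiltration (htop : Algebra.adjoin F (Set.range e) = ⊤) {k : ℕ} {x : A}
    (hx : x ∈ cs.lengthFiltration F e k) (y : A) : x * y ∈ cs.lengthFiltration F e k := by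
  have hy : y ∈ Algebra.adjoin F (Set.range e) := htop ▸ Algebra.mem_top
  induction hy using Algebra.adjoin_induction generalizing x with
  | mem y hy =>
    obtain ⟨i, rfl⟩ := hy
    exact cs.mul_gen_mem_lengthFiltration hb hi hx i
  | algebraMap r =>
    rw [← Algebra.commutes, ← Algebra.smul_def]
    exact Submodule.smul_mem _ r hx
  | add y z _ _ hy hz => rw [mul_add]; exact add_mem (hy hx) (hz hx)
  | mul y z _ _ hy hz => rw [← mul_assoc]; exact hz (hy hx)

theorem mem_lengthFiltration_zero (htop : Algebra.adjoin F (Set.range e) = ⊤) (y : A) :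
    y ∈ cs.lengthFiltration F e 0 := by
  have h := cs.mul_mem_lengthFiltration hb hi htop
    (cs.reducedProd_mem_lengthFiltration (w := 1) (Nat.zero_le _)) y
  rwa [hb.reducedProd_one, one_mul] at h

/-- Expanding the first factor `1 - e i` leaves the shorter product minus a term starting with the
longer element `w s_i`, and the filtration is stable under right multiplication. -/
theorem reducedProd_mul_sub_mem_lengthFiltration (htop : Algebra.adjoin F (Set.range e) = ⊤)
    {w : W} {J : Set B} (hw : ∀ i ∈ J, ¬ cs.IsRightDescent w i) {ω : List B}
    (hω : ∀ i ∈ ω, i ∈ J) :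
    cs.reducedProd e w * (ω.map (fun i => 1 - e i)).prod - cs.reducedProd e w ∈
      cs.lengthFiltration F e (cs.length w + 1) := by
  induction ω with
  | nil => simp
  | cons i ω ih =>
    have ih := ih fun j hj => hω j (by simp [hj])
    have h := (cs.not_isRightDescent_iff).mp (hw i (hω i (by simp)))
    rw [List.map_cons, List.prod_cons, ← mul_assoc, mul_sub, mul_one, sub_mul,
      hb.reducedProd_mul_of_lt cs h, sub_right_comm]
    exact sub_mem ih (cs.mul_mem_lengthFiltration hb hi htop
      (cs.reducedProd_mem_lengthFiltration h.ge) _)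

variable [Finite W] (hb' : IsBraided M (fun i => 1 - e i))
  (htop : Algebra.adjoin F (Set.range e) = ⊤) {I J : Set B}
include hb' htop

/-- The heart of the argument: right multiplication by `c` is idempotent up to an error that lies
deeper in the filtration and is again a multiple of `c`. -/
theorem exists_mem_lengthFiltration_mul_sub_eq {k : ℕ} {y : A}
    (hy : y ∈ cs.lengthFiltration F e k) :
    let c := cs.reducedProd e (cs.longest I) * cs.reducedProd (fun i => 1 - e i) (cs.longest J)
    ∃ z ∈ cs.lengthFiltration F e (k + 1), y * c - y * (c * c) = z * c := by
  intro c
  have hi' (i : B) : (1 - e i) * (1 - e i) = 1 - e i := by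
    rw [sub_mul, one_mul, mul_sub, mul_one, hi, sub_self, sub_zero]
  induction hy using Submodule.span_induction with
  | mem y hy =>
    obtain ⟨u, hu, rfl⟩ := hy
    obtain ⟨ω, hω, hωb⟩ := cs.exists_reducedWord_longest hb I
    obtain ⟨τ, hτ, hτa⟩ := cs.exists_reducedWord_longest hb' J
    set b := cs.reducedProd e (cs.longest I) with hbdef
    set a := cs.reducedProd (fun i => 1 - e i) (cs.longest J) with hadef
    have hbb : b * b = b := by
      conv_lhs => rw [hωb, ← hωb]
      nth_rw 2 [hωb]
      exact mul_prod_eq_self (fun i h => hb.reducedProd_longest_mul cs hi h) hω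
    obtain ⟨w, hw, hwb⟩ := cs.exists_reducedProd_mul_eq hb hi u ω
    rw [← hωb] at hwb
    have hc (x : A) : x * c = x * b * a := (mul_assoc _ _ _).symm
    by_cases hd : ∃ i ∈ J, cs.IsRightDescent w i
    · obtain ⟨i, hiJ, hd⟩ := hd
      -- A right descent absorbs `e i`, while `a` absorbs `1 - e i` on the left, and `e i * (1 - e
      -- i) = 0`.
      have h0 : cs.reducedProd e w * a = 0 := by
        have ha : (1 - e i) * a = a := hb'.mul_reducedProd_longest cs hi' hiJ
        rw [← ha, ← mul_assoc, mul_sub, mul_one,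
          hb.reducedProd_mul_of_gt cs hi (cs.isRightDescent_iff.mp hd), sub_self, zero_mul]
      refine ⟨0, zero_mem _, ?_⟩
      rw [← mul_assoc _ c c, hc (cs.reducedProd e u), hwb, h0]
      simp
    · push Not at hd
      have h1 := cs.reducedProd_mul_sub_mem_lengthFiltration hb hi htop hd hτ
      rw [← hτa] at h1
      have hww : cs.reducedProd e w * b = cs.reducedProd e w := by
        rw [← hwb, mul_assoc, hbb]
      -- Here `e_u c = e_w a` and, because `e_w b = e_w`, also `e_w c = e_w a`. Hence `e_u c - e_u
      -- c² = (e_w - e_w a) c`.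
      refine ⟨-(cs.reducedProd e w * a - cs.reducedProd e w), neg_mem ?_, ?_⟩
      · refine Submodule.span_mono ?_ h1
        rintro _ ⟨v, hv, rfl⟩
        exact ⟨v, by omega, rfl⟩
      · rw [← mul_assoc _ c c, hc (cs.reducedProd e u), hwb, neg_sub, sub_mul, hc (cs.reducedProd e w),
          hww]
  | zero => exact ⟨0, zero_mem _, by simp⟩
  | add x y _ _ hx hy =>
    obtain ⟨z1, h1, h1'⟩ := hx
    obtain ⟨z2, h2, h2'⟩ := hy
    exact ⟨z1 + z2, add_mem h1 h2, by rw [add_mul z1, ← h1', ← h2', add_mul, add_mul]; abel⟩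
  | smul r x _ hx =>
    obtain ⟨z, h1, h1'⟩ := hx
    exact ⟨r • z, Submodule.smul_mem _ r h1, by
      rw [smul_mul_assoc, smul_mul_assoc, smul_mul_assoc, ← smul_sub, h1']⟩

theorem mul_eq_zero_of_mul_mul_eq_zero {y : A}
    (hy : y * (cs.reducedProd e (cs.longest I) * cs.reducedProd (fun i => 1 - e i) (cs.longest J) *
      (cs.reducedProd e (cs.longest I) * cs.reducedProd (fun i => 1 - e i) (cs.longest J))) = 0) :
    y * (cs.reducedProd e (cs.longest I) * cs.reducedProd (fun i => 1 - e i) (cs.longest J)) =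
      0 := by
  set c := cs.reducedProd e (cs.longest I) * cs.reducedProd (fun i => 1 - e i) (cs.longest J)
    with hc
  -- With `y c² = 0` the error formula lets `y` be replaced by ever deeper elements without changing
  -- `y c`.
  have h (k : ℕ) : ∃ z ∈ cs.lengthFiltration F e k, y * c = z * c := by
    induction k with
    | zero => exact ⟨y, cs.mem_lengthFiltration_zero hb hi htop y, rfl⟩
    | succ k ih =>
      obtain ⟨z, hz, h⟩ := ih
      obtain ⟨z', hz', h'⟩ := cs.exists_mem_lengthFiltration_mul_sub_eq hb hi hb' htop (I := I)
        (J := J) hz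
      refine ⟨z', hz', ?_⟩
      rw [← h', ← hc, ← mul_assoc z c c, ← h, mul_assoc, hy, sub_zero]
  obtain ⟨z, hz, h⟩ := h (cs.length (cs.longest Set.univ) + 1)
  rw [lengthFiltration_eq_bot cs (Nat.lt_succ_self _), Submodule.mem_bot] at hz
  rw [h, hz, zero_mul]

theorem exists_mul_mul_eq :
    ∃ z, cs.reducedProd e (cs.longest I) * cs.reducedProd (fun i => 1 - e i) (cs.longest J) =
      z * (cs.reducedProd e (cs.longest I) * cs.reducedProd (fun i => 1 - e i) (cs.longest J) *
      (cs.reducedProd e (cs.longest I) * cs.reducedProd (fun i => 1 - e i) (cs.longest J))) := by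
  set c := cs.reducedProd e (cs.longest I) * cs.reducedProd (fun i => 1 - e i) (cs.longest J)
    with hc
  -- Descending induction on the filtration step `k`, from the step that vanishes up to `k = 0`,
  -- which contains `1`.
  have h (d k : ℕ) (hk : k + d = cs.length (cs.longest Set.univ) + 1) (y : A)
      (hy : y ∈ cs.lengthFiltration F e k) : ∃ z, y * c = z * (c * c) := by
    induction d generalizing k y with
    | zero =>
      rw [lengthFiltration_eq_bot cs (by omega), Submodule.mem_bot] at hy
      exact ⟨0, by rw [hy, zero_mul, zero_mul]⟩
    | succ d ih =>
      obtain ⟨z', hz', h'⟩ := cs.exists_mem_lengthFiltration_mul_sub_eq hb hi hb' htop (I := I)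
        (J := J) hy
      obtain ⟨z, hz⟩ := ih (k + 1) (by omega) z' hz'
      refine ⟨z + y, ?_⟩
      rw [add_mul, ← hz, hc, ← h', sub_add_cancel]
  obtain ⟨z, hz⟩ := h _ 0 (zero_add _) 1 (cs.mem_lengthFiltration_zero hb hi htop 1)
  exact ⟨z, by rw [← hz, one_mul]⟩

end Filtration

end CoxeterSystem

/-! ### Twisted modules, tops, and exchanging the factors of a generator -/

section Twisting

variable {F H : Type*} [CommRing F] [Ring H] [Algebra F H]

namespace Twist

variable (f : H ≃ₐ[F] H) {N N' : Type*} [AddCommGroup N] [Module H N] [AddCommGroup N']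
  [Module H N']

/-- Twisting is functorial. -/
def congr (e : N ≃ₗ[H] N') : Twist f N ≃ₗ[H] Twist f N' where
  __ := ((of f N).symm.trans e.toAddEquiv).trans (of f N')
  map_smul' a x := e.map_smul (f a) x

/-- With these pairs the identity `N → f[N]` is a semilinear bijection, and such maps preserve the
radical. -/
instance ringHomInvPair :
    RingHomInvPair (f.symm.toRingEquiv : H →+* H) (f.toRingEquiv : H →+* H) where
  comp_eq := RingHom.ext f.apply_symm_apply
  comp_eq₂ := RingHom.ext f.symm_apply_apply

instance ringHomInvPair_symm :
    RingHomInvPair (f.toRingEquiv : H →+* H) (f.symm.toRingEquiv : H →+* H) where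
  comp_eq := RingHom.ext f.symm_apply_apply
  comp_eq₂ := RingHom.ext f.apply_symm_apply

/-- The identity map, as a semilinear equivalence between `N` and `f[N]`. -/
def semilinearEquiv (N : Type*) [AddCommGroup N] [Module H N] :
    N ≃ₛₗ[(f.symm.toRingEquiv : H →+* H)] Twist f N where
  __ := of f N
  map_smul' a x := by
    have h := smul_of f N (f.symm a) x
    rw [AlgEquiv.apply_symm_apply] at h
    exact h.symm

/-- Twisting commutes with the passage to the top of a module. -/
noncomputable def quotientJacobsonEquiv (N : Type*) [AddCommGroup N] [Module H N] :
    Twist f (N ⧸ Module.jacobson H N) ≃ₗ[H] Twist f N ⧸ Module.jacobson H (Twist f N) :=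
  let E := Submodule.Quotient.equiv (Module.jacobson H N) (Module.jacobson H (Twist f N))
    (semilinearEquiv f N)
    (Module.map_jacobson_of_bijective (f := (semilinearEquiv f N).toLinearMap)
      (semilinearEquiv f N).bijective)
  { (of f (N ⧸ Module.jacobson H N)).symm.trans E.toAddEquiv with
    map_smul' := fun a x => by
      -- The twist by `f` on the source cancels the semilinearity along `f.symm`.
      have h := E.map_smulₛₗ (f a) ((of f (N ⧸ Module.jacobson H N)).symm x)
      have ha : (f.symm.toRingEquiv : H →+* H) (f a) = a := f.symm_apply_apply a
      rw [ha] at h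
      exact h }

/-- Isomorphic modules have isomorphic tops. -/
noncomputable def _root_.LinearEquiv.quotientJacobson (e : N ≃ₗ[H] N') :
    (N ⧸ Module.jacobson H N) ≃ₗ[H] N' ⧸ Module.jacobson H N' :=
  Submodule.Quotient.equiv _ _ e
    (Module.map_jacobson_of_bijective (f := e.toLinearMap) e.bijective)

end Twist

/-- If `f` is an involution then `f(P) ≅ f[P]`. -/
def imageIdealEquivTwist (f : H ≃ₐ[F] H) (hf : ∀ x, f (f x) = x) (P : Submodule H H) :
    imageIdeal f P ≃ₗ[H] Twist f P where
  toFun x := Twist.of f P ⟨f x, by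
    obtain ⟨_, y, hy, rfl⟩ := x
    rw [hf]
    exact hy⟩
  invFun x := ⟨f ((Twist.of f P).symm x : P), _, ((Twist.of f P).symm x).2, rfl⟩
  map_add' x y := congrArg (Twist.of f P) (Subtype.ext (map_add f (x : H) y))
  map_smul' a x := congrArg (Twist.of f P) (Subtype.ext (map_mul f a (x : H)))
  left_inv x := Subtype.ext (hf x)
  right_inv x := congrArg (Twist.of f P) (Subtype.ext (hf ((Twist.of f P).symm x : P)))

theorem imageIdeal_span_singleton (f : H ≃ₐ[F] H) (x : H) :
    imageIdeal f (Submodule.span H {x}) = Submodule.span H {f x} := by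
  ext y
  rw [Submodule.mem_span_singleton]
  constructor
  · rintro ⟨z, hz, rfl⟩
    obtain ⟨a, rfl⟩ := Submodule.mem_span_singleton.mp hz
    exact ⟨f a, by simp⟩
  · rintro ⟨a, rfl⟩
    exact ⟨f.symm a * x, Submodule.mem_span_singleton.mpr ⟨f.symm a, rfl⟩, by simp⟩

/-- The map is right multiplication by `b`. Following it by `a` gives `y ba ↦ y (ba)²`, whence
injectivity from `h1`; and `y ab = y z (ab)²` ends in `b` after an element of `H ba`, whence
surjectivity from `h2`. -/
theorem nonempty_span_mul_equiv {a b : H} (h1 : ∀ y, y * (b * a * (b * a)) = 0 → y * (b * a) = 0)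
    (h2 : ∃ z, a * b = z * (a * b * (a * b))) :
    Nonempty (Submodule.span H {b * a} ≃ₗ[H] Submodule.span H {a * b}) := by
  have hmap : ∀ x ∈ Submodule.span H {b * a},
      LinearMap.toSpanSingleton H H b x ∈ Submodule.span H {a * b} := by
    intro x hx
    obtain ⟨y, rfl⟩ := Submodule.mem_span_singleton.mp hx
    exact Submodule.mem_span_singleton.mpr ⟨y * b, by simp [mul_assoc]⟩
  refine ⟨LinearEquiv.ofBijective ((LinearMap.toSpanSingleton H H b).restrict hmap) ⟨?_, ?_⟩⟩
  · rw [injective_iff_map_eq_zero]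
    rintro ⟨x, hx⟩ h
    obtain ⟨y, rfl⟩ := Submodule.mem_span_singleton.mp hx
    have h0 : y * (b * a) * b = 0 := congrArg Subtype.val h
    refine Subtype.ext (h1 y ?_)
    rw [← mul_assoc, ← mul_assoc _ b a, h0, zero_mul]
  · rintro ⟨x, hx⟩
    obtain ⟨y, rfl⟩ := Submodule.mem_span_singleton.mp hx
    obtain ⟨z, hz⟩ := h2
    refine ⟨⟨y * z * a * (b * a), Submodule.mem_span_singleton.mpr ⟨_, rfl⟩⟩, Subtype.ext ?_⟩
    change y * z * a * (b * a) * b = y * (a * b)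
    rw [hz]
    simp only [mul_assoc]

end Twisting

/-! ### The automorphisms `θ` and `φ` and their effect on the ideals -/

namespace HeckeZero

variable (F : Type*) [Field F] {B : Type*} (M : CoxeterMatrix B)

theorem isBraided_gen : CoxeterSystem.IsBraided M (gen F M) := braid F M

theorem one_sub_gen_mul_self (i : B) : (1 - gen F M i) * (1 - gen F M i) = 1 - gen F M i := by
  rw [sub_mul, one_mul, mul_sub, mul_one, gen_mul_self, sub_self, sub_zero]

theorem isBraided_one_sub_gen : CoxeterSystem.IsBraided M (fun i => 1 - gen F M i) := by
  intro i j
  have h := compl_alternating_sub (gen F M) (gen_mul_self F M) i j (M i j)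
  rw [braid F M i j, sub_self, mul_zero] at h
  exact sub_eq_zero.mp h

theorem adjoin_range_gen : Algebra.adjoin F (Set.range (gen F M)) = ⊤ := by
  have h := congrArg (Subalgebra.map (mk F M)) (FreeAlgebra.adjoin_range_ι F B)
  rw [AlgHom.map_adjoin, ← Set.range_comp, Algebra.map_top,
    (AlgHom.range_eq_top (mk F M)).mpr (RingQuot.mkAlgHom_surjective F (Rel F M))] at h
  exact h

theorem adjoin_range_one_sub_gen :
    Algebra.adjoin F (Set.range (fun i => 1 - gen F M i)) = ⊤ := by
  rw [eq_top_iff, ← adjoin_range_gen, Algebra.adjoin_le_iff]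
  rintro _ ⟨i, rfl⟩
  have h := sub_mem (one_mem (Algebra.adjoin F (Set.range (fun i => 1 - gen F M i))))
    (Algebra.subset_adjoin ⟨i, rfl⟩)
  simpa using h

theorem theta_theta (x : HeckeZero F M) : theta F M (theta F M x) = x :=
  AlgHom.congr_fun (thetaHom_comp F M) x

end HeckeZero

namespace CoxeterSystem

variable {B W : Type*} [Group W] {M : CoxeterMatrix B} (cs : CoxeterSystem M W)
  (F : Type*) [Field F]

open HeckeZero

theorem theta_pi (w : W) :
    theta F M (cs.pi F w) = cs.reducedProd (fun i => 1 - gen F M i) w := by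
  rw [pi, map_list_prod, List.map_map, reducedProd]
  congr 2
  funext i
  exact theta_gen F M i

theorem piBar_eq (w : W) :
    cs.piBar F w = (-1) ^ (cs.reducedExpr w).length * theta F M (cs.pi F w) := by
  rw [theta_pi, reducedProd, piBar]
  induction cs.reducedExpr w with
  | nil => simp
  | cons i ω ih =>
    rw [List.map_cons, List.prod_cons, ih, List.map_cons, List.prod_cons, List.length_cons,
      pow_succ, genBar]
    have h : Commute ((-1 : HeckeZero F M) ^ ω.length) (gen F M i - 1) :=
      (Commute.neg_one_left _).pow_left _
    rw [← mul_assoc, ← h.eq]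
    noncomm_ring

theorem pi_simple (i : B) : cs.pi F (cs.simple i) = gen F M i :=
  (isBraided_gen F M).reducedProd_simple cs i

variable [Finite W]

theorem proj_eq_span (I : Set B) :
    cs.proj F I = Submodule.span (HeckeZero F M)
      {theta F M (cs.pi F (cs.longest I)) * cs.pi F (cs.longest Iᶜ)} := by
  rw [proj, piBar_eq, mul_assoc]
  rcases neg_one_pow_eq_or (HeckeZero F M) (cs.reducedExpr (cs.longest I)).length with h | h
  · rw [h, one_mul]
  · rw [h, neg_one_mul, ← Set.neg_singleton, Submodule.span_neg]

theorem imageIdeal_theta_proj (I : Set B) :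
    imageIdeal (theta F M) (cs.proj F I) = Submodule.span (HeckeZero F M)
      {cs.pi F (cs.longest I) * theta F M (cs.pi F (cs.longest Iᶜ))} := by
  rw [proj_eq_span, imageIdeal_span_singleton, map_mul, theta_theta]

theorem nonempty_imageIdeal_theta_equiv (I : Set B) :
    Nonempty (imageIdeal (theta F M) (cs.proj F I) ≃ₗ[HeckeZero F M] cs.proj F Iᶜ) := by
  rw [imageIdeal_theta_proj, proj_eq_span, compl_compl]
  refine nonempty_span_mul_equiv (fun y hy => ?_) ?_
  · rw [theta_pi] at hy ⊢
    exact cs.mul_eq_zero_of_mul_mul_eq_zero (isBraided_gen F M) (gen_mul_self F M)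
      (isBraided_one_sub_gen F M) (adjoin_range_gen F M) hy
  · rw [theta_pi]
    -- The same filtration argument, now with the roles of `π_s` and `1 - π_s` exchanged.
    have h := cs.exists_mul_mul_eq (isBraided_one_sub_gen F M) (one_sub_gen_mul_self F M)
      (by simpa using isBraided_gen F M) (adjoin_range_one_sub_gen F M) (I := Iᶜ) (J := I)
    simp only [sub_sub_cancel] at h
    exact h

/-- Conjugation by `w₀` preserves length, and the elements of length one are the simple reflections.
-/
theorem exists_unique_isSigma : ∃! σ : Equiv.Perm B, cs.IsSigma σ := by
  have h (i : B) : ∃ j, cs.longest Set.univ * cs.simple i * cs.longest Set.univ = cs.simple j := by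
    rw [← length_eq_one_iff, length_longest_conj, length_simple]
  choose σ hσ using h
  have hinv : Function.Involutive σ := by
    intro i
    apply cs.simple_injective
    rw [← hσ, ← hσ]
    simp only [← mul_assoc, longest_mul_longest, one_mul]
    rw [mul_assoc, longest_mul_longest, mul_one]
  refine ⟨hinv.toPerm, hσ, fun τ hτ => Equiv.ext fun i => cs.simple_injective ?_⟩
  rw [← hτ i, hσ i]
  rfl

variable {cs}

theorem IsSigma.involutive {σ : Equiv.Perm B} (hσ : cs.IsSigma σ) (i : B) : σ (σ i) = i := by
  apply cs.simple_injective
  rw [← hσ, ← hσ]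
  simp only [← mul_assoc, longest_mul_longest, one_mul]
  rw [mul_assoc, longest_mul_longest, mul_one]

theorem IsSigma.coxeterMatrix_apply {σ : Equiv.Perm B} (hσ : cs.IsSigma σ) (i j : B) :
    M (σ i) (σ j) = M i j := by
  have hinv : (cs.longest Set.univ)⁻¹ = cs.longest Set.univ :=
    inv_eq_of_mul_eq_one_left cs.longest_mul_longest
  rw [← cs.orderOf_simple_mul_simple, ← cs.orderOf_simple_mul_simple, ← hσ, ← hσ,
    ← MulEquiv.orderOf_eq (MulAut.conj (cs.longest Set.univ)) (cs.simple i * cs.simple j)]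
  congr 1
  rw [map_mul, MulAut.conj_apply, MulAut.conj_apply, hinv]

variable {F}

theorem IsPhi.apply_gen {φ : HeckeZero F M ≃ₐ[F] HeckeZero F M} (hφ : cs.IsPhi F φ)
    {σ : Equiv.Perm B} (hσ : cs.IsSigma σ) (i : B) : φ (gen F M i) = gen F M (σ i) := by
  rw [hφ i, hσ i, pi_simple]

variable (cs F)

theorem exists_unique_isPhi : ∃! φ : HeckeZero F M ≃ₐ[F] HeckeZero F M, cs.IsPhi F φ := by
  obtain ⟨σ, hσ, -⟩ := cs.exists_unique_isSigma
  let f : HeckeZero F M →ₐ[F] HeckeZero F M :=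
    HeckeZero.lift (fun i => gen F M (σ i)) (fun i => gen_mul_self F M _) (fun i j => by
      have h := braid F M (σ i) (σ j)
      rw [hσ.coxeterMatrix_apply] at h
      have hmap (k : ℕ) (i j : B) : ((alternatingWord i j k).map fun i => gen F M (σ i)) =
          (alternatingWord (σ i) (σ j) k).map (gen F M) := by
        induction k generalizing i j with
        | zero => rfl
        | succ k ih => simp [alternatingWord_succ, ih]
      rwa [hmap, hmap])
  have hf (i : B) : f (gen F M i) = gen F M (σ i) := lift_gen _ _ _ i
  have hff : f.comp f = AlgHom.id F (HeckeZero F M) := by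
    apply algHom_ext
    intro i
    rw [AlgHom.comp_apply, hf, hf, hσ.involutive, AlgHom.id_apply]
  refine ⟨AlgEquiv.ofAlgHom f f hff hff, fun i => ?_, fun ψ hψ => ?_⟩
  · rw [hσ i, pi_simple]
    exact hf i
  · apply AlgEquiv.coe_toAlgHom_injective
    apply algHom_ext
    intro i
    exact (hψ.apply_gen hσ i).trans (hf i).symm

variable {cs F}

/-- Both sides are products of generators indexed by `σ(I)`, and both absorb every such generator.
Their product therefore equals each of them. -/
theorem IsPhi.apply_pi_longest {φ : HeckeZero F M ≃ₐ[F] HeckeZero F M} (hφ : cs.IsPhi F φ)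
    {σ : Equiv.Perm B} (hσ : cs.IsSigma σ) (I : Set B) :
    φ (cs.pi F (cs.longest I)) = cs.pi F (cs.longest (σ '' I)) := by
  obtain ⟨ω, hω, hprod⟩ := cs.exists_reducedWord_longest (isBraided_gen F M) I
  obtain ⟨τ, hτ, hprod'⟩ := cs.exists_reducedWord_longest (isBraided_gen F M) (σ '' I)
  have hφprod : φ (cs.pi F (cs.longest I)) = ((ω.map σ).map (gen F M)).prod := by
    rw [show cs.pi F (cs.longest I) = _ from hprod, map_list_prod, List.map_map, List.map_map]
    congr 2
    funext i
    exact hφ.apply_gen hσ i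
  have h1 : φ (cs.pi F (cs.longest I)) * cs.pi F (cs.longest (σ '' I)) =
      cs.pi F (cs.longest (σ '' I)) := by
    rw [hφprod]
    refine prod_mul_eq_self (I := σ '' I) (fun i hi =>
      (isBraided_gen F M).mul_reducedProd_longest cs (gen_mul_self F M) hi) fun i hi => ?_
    obtain ⟨j, hj, rfl⟩ := List.mem_map.mp hi
    exact ⟨j, hω j hj, rfl⟩
  have h2 : φ (cs.pi F (cs.longest I)) * cs.pi F (cs.longest (σ '' I)) =
      φ (cs.pi F (cs.longest I)) := by
    rw [show cs.pi F (cs.longest (σ '' I)) = _ from hprod']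
    refine mul_prod_eq_self (I := σ '' I) ?_ hτ
    rintro _ ⟨i, hi, rfl⟩
    rw [← hφ.apply_gen hσ, ← map_mul]
    exact congrArg φ
      ((isBraided_gen F M).reducedProd_longest_mul cs (gen_mul_self F M) hi)
  exact h2.symm.trans h1

theorem IsPhi.involutive {φ : HeckeZero F M ≃ₐ[F] HeckeZero F M} (hφ : cs.IsPhi F φ)
    (x : HeckeZero F M) : φ (φ x) = x := by
  obtain ⟨σ, hσ, -⟩ := cs.exists_unique_isSigma
  have h : (φ : HeckeZero F M →ₐ[F] HeckeZero F M).comp φ = AlgHom.id F (HeckeZero F M) := by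
    apply algHom_ext
    intro i
    simp [hφ.apply_gen hσ, hσ.involutive]
  exact AlgHom.congr_fun h x

theorem IsPhi.theta_comm {φ : HeckeZero F M ≃ₐ[F] HeckeZero F M} (hφ : cs.IsPhi F φ)
    (x : HeckeZero F M) : theta F M (φ x) = φ (theta F M x) := by
  obtain ⟨σ, hσ, -⟩ := cs.exists_unique_isSigma
  have h : (theta F M : HeckeZero F M →ₐ[F] HeckeZero F M).comp φ =
      (φ : HeckeZero F M →ₐ[F] HeckeZero F M).comp
        (theta F M : HeckeZero F M →ₐ[F] HeckeZero F M) := by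
    apply algHom_ext
    intro i
    simp [hφ.apply_gen hσ, theta_gen]
  exact AlgHom.congr_fun h x

theorem IsPhi.imageIdeal_proj {φ : HeckeZero F M ≃ₐ[F] HeckeZero F M} (hφ : cs.IsPhi F φ)
    {σ : Equiv.Perm B} (hσ : cs.IsSigma σ) (I : Set B) :
    imageIdeal φ (cs.proj F I) = cs.proj F (σ '' I) := by
  rw [proj_eq_span, proj_eq_span, imageIdeal_span_singleton, map_mul, ← hφ.theta_comm,
    hφ.apply_pi_longest hσ, hφ.apply_pi_longest hσ, Set.image_compl_eq σ.bijective]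

theorem IsPhi.nonempty_proj_equiv_twist {φ : HeckeZero F M ≃ₐ[F] HeckeZero F M}
    (hφ : cs.IsPhi F φ) {σ : Equiv.Perm B} (hσ : cs.IsSigma σ) (I : Set B) :
    Nonempty (cs.proj F (σ '' I) ≃ₗ[HeckeZero F M] Twist φ (cs.proj F I)) := by
  rw [← hφ.imageIdeal_proj hσ]
  exact ⟨imageIdealEquivTwist φ hφ.involutive _⟩

variable (cs F) in
theorem nonempty_proj_compl_equiv_twist (I : Set B) :
    Nonempty (cs.proj F Iᶜ ≃ₗ[HeckeZero F M] Twist (theta F M) (cs.proj F I)) := by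
  obtain ⟨e⟩ := cs.nonempty_imageIdeal_theta_equiv F I
  exact ⟨e.symm.trans (imageIdealEquivTwist _ (theta_theta F M) _)⟩

end CoxeterSystem

/-! ### Descent sets of reversed and transposed compositions -/

namespace Composition

variable {n : ℕ}

theorem sizeUpTo_reverse (c : Composition n) (k : ℕ) :
    c.reverse.sizeUpTo k + c.sizeUpTo (c.length - k) = n := by
  have h : c.reverse.sizeUpTo k = (c.blocks.drop (c.length - k)).sum := by
    rw [sizeUpTo, reverse, List.take_reverse, List.sum_reverse]
  rw [h, sizeUpTo, add_comm, List.sum_take_add_sum_drop, c.blocks_sum]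

theorem descentSet_reverse (c : Composition n) :
    c.reverse.descentSet = Fin.rev '' c.descentSet := by
  have key (c : Composition n) (i : Fin (n - 1)) (h : i ∈ c.reverse.descentSet) :
      i.rev ∈ c.descentSet := by
    obtain ⟨k, h0, hk, he⟩ := h
    have hl : c.reverse.length = c.length := by simp [Composition.length, reverse]
    rw [hl] at hk
    refine ⟨c.length - k, by omega, by omega, ?_⟩
    have h1 := c.sizeUpTo_reverse k
    have h2 := i.2
    rw [Fin.val_rev]
    omega
  ext i
  constructor
  · intro h
    exact ⟨i.rev, key c i h, Fin.rev_rev i⟩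
  · rintro ⟨j, hj, rfl⟩
    exact key c.reverse j (by rwa [reverse_reverse])

theorem descentSet_transpose (c : Composition n) :
    c.transpose.descentSet = Fin.rev '' c.descentSetᶜ := by
  rw [transpose, descentSet_reverse, descentSet_complement]

end Composition

/-! ### Type A: `σ` reverses the diagram -/

namespace Equiv.Perm

/-- A permutation of `ℕ` that fixes all numbers above `m` and takes neighbours in `{0, …, m}` to
neighbours is the identity or reverses `{0, …, m}`. -/
theorem eq_one_or_forall_eq_sub {m : ℕ} {g : Equiv.Perm ℕ} (hfix : ∀ x, m < x → g x = x)
    (hadj : ∀ i < m, g (i + 1) = g i + 1 ∨ g i = g (i + 1) + 1) :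
    g = 1 ∨ ∀ i ≤ m, g i = m - i := by
  have hle (x : ℕ) (hx : x ≤ m) : g x ≤ m := by
    by_contra h
    have := g.injective (hfix (g x) (by omega))
    omega
  rcases Nat.eq_zero_or_pos m with rfl | hm
  · right
    intro i hi
    have := hle i hi
    omega
  -- Injectivity forbids turning back, so the first step fixes the direction of all the others.
  have hne (i : ℕ) : g (i + 1 + 1) ≠ g i := fun h => by
    have := g.injective h
    omega
  have hadj0 := hadj 0 hm
  rw [zero_add] at hadj0
  rcases hadj0 with h0 | h0
  · left
    have hstep (i : ℕ) (hi : i < m) : g (i + 1) = g i + 1 := by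
      induction i with
      | zero => exact h0
      | succ i ih =>
        have h1 := ih (by omega)
        rcases hadj (i + 1) hi with h | h
        · exact h
        · have := hne i
          omega
    have hall (i : ℕ) (hi : i ≤ m) : g i = g 0 + i := by
      induction i with
      | zero => rfl
      | succ i ih => rw [hstep i (by omega), ih (by omega), add_assoc]
    have h00 : g 0 = 0 := by
      have := hle m le_rfl
      rw [hall m le_rfl] at this
      omega
    ext i
    rcases le_or_gt i m with h | h
    · rw [hall i h, h00, zero_add, one_apply]
    · rw [hfix i h, one_apply]
  · right
    have hstep (i : ℕ) (hi : i < m) : g i = g (i + 1) + 1 := by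
      induction i with
      | zero => exact h0
      | succ i ih =>
        have h1 := ih (by omega)
        rcases hadj (i + 1) hi with h | h
        · have := hne i
          omega
        · exact h
    have hall (i : ℕ) (hi : i ≤ m) : g 0 = g i + i := by
      induction i with
      | zero => rfl
      | succ i ih =>
        have := hstep i (by omega)
        have := ih (by omega)
        omega
    intro i hi
    have h1 := hall m le_rfl
    have h2 := hle 0 (by omega)
    have h3 := hall i hi
    omega

end Equiv.Perm

namespace CoxeterSystem

section TypeA

variable {W : Type*} [Group W] {m : ℕ} (cs : CoxeterSystem (CoxeterMatrix.A m) W)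

theorem isLiftable_swap_succ :
    (CoxeterMatrix.A m).IsLiftable fun i : Fin m => Equiv.swap (i : ℕ) (i + 1) := by
  intro i j
  have hval : (CoxeterMatrix.A m) i j =
    if i = j then 1 else (if (j : ℕ) + 1 = i ∨ (i : ℕ) + 1 = j then 3 else 2) := rfl
  rw [hval]
  split_ifs with h1 h2
  · subst h1
    simp
  · ext x
    simp only [pow_succ, pow_zero, one_mul, Equiv.Perm.mul_apply, Equiv.Perm.one_apply,
      Equiv.swap_apply_def]
    grind
  · have h1' : (i : ℕ) ≠ j := fun h => h1 (Fin.ext h)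
    ext x
    simp only [pow_succ, pow_zero, one_mul, Equiv.Perm.mul_apply, Equiv.Perm.one_apply,
      Equiv.swap_apply_def]
    grind

/-- The action of the Coxeter group of type `A_m` on the natural numbers in which `s_i`
interchanges `i` and `i + 1`. -/
noncomputable def permHom : W →* Equiv.Perm ℕ := cs.lift ⟨_, isLiftable_swap_succ⟩

theorem permHom_simple (i : Fin m) :
    cs.permHom (cs.simple i) = Equiv.swap (i : ℕ) (i + 1) :=
  cs.lift_apply_simple isLiftable_swap_succ i

theorem permHom_apply_of_mem_parabolic {k : ℕ} {w : W}
    (hw : w ∈ cs.parabolic {i | (i : ℕ) < k}) {x : ℕ} (hx : k < x) : cs.permHom w x = x := by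
  refine Subgroup.closure_induction (p := fun w _ => cs.permHom w x = x) ?_ (by simp) ?_ ?_ hw
  · rintro _ ⟨i, hi, rfl⟩
    have hi : (i : ℕ) < k := hi
    rw [permHom_simple, Equiv.swap_apply_of_ne_of_ne] <;> omega
  · intro u v _ _ hu hv
    rw [map_mul, Equiv.Perm.mul_apply, hv, hu]
  · intro u _ hu
    rw [map_inv, Equiv.Perm.inv_eq_iff_eq, hu]

/-- The simple reflection with a natural number as index, or `1` if the index is out of range. -/
noncomputable def natSimple (j : ℕ) : W := if h : j < m then cs.simple ⟨j, h⟩ else 1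

theorem natSimple_of_lt {j : ℕ} (h : j < m) : cs.natSimple j = cs.simple ⟨j, h⟩ := dif_pos h

theorem natSimple_mul_self (j : ℕ) : cs.natSimple j * cs.natSimple j = 1 := by
  unfold natSimple
  split_ifs <;> simp

theorem natSimple_comm {i j : ℕ} (hij : i + 1 < j) :
    cs.natSimple i * cs.natSimple j = cs.natSimple j * cs.natSimple i := by
  unfold natSimple
  split_ifs with hi hj <;> try simp
  have h := cs.simple_mul_simple_pow ⟨i, hi⟩ ⟨j, hj⟩
  have hval : (CoxeterMatrix.A m) ⟨i, hi⟩ ⟨j, hj⟩ = 2 := by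
    change (if (⟨i, hi⟩ : Fin m) = ⟨j, hj⟩ then 1 else if j + 1 = i ∨ i + 1 = j then 3 else 2) = 2
    rw [if_neg (by simp; omega), if_neg (by omega)]
  rw [hval, pow_two, mul_eq_one_iff_eq_inv, mul_inv_rev, inv_simple, inv_simple] at h
  exact h

theorem natSimple_braid {i : ℕ} (hi : i + 1 < m) :
    cs.natSimple i * cs.natSimple (i + 1) * cs.natSimple i =
      cs.natSimple (i + 1) * cs.natSimple i * cs.natSimple (i + 1) := by
  rw [cs.natSimple_of_lt hi, cs.natSimple_of_lt (by omega : i < m)]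
  have h := cs.simple_mul_simple_pow ⟨i, by omega⟩ ⟨i + 1, hi⟩
  have hval : (CoxeterMatrix.A m) ⟨i, by omega⟩ ⟨i + 1, hi⟩ = 3 := by
    change (if (⟨i, _⟩ : Fin m) = ⟨i + 1, hi⟩ then 1 else
      if i + 1 + 1 = i ∨ i + 1 = i + 1 then 3 else 2) = 3
    rw [if_neg (by simp), if_pos (by simp)]
  rw [hval] at h
  have h' : cs.simple ⟨i, by omega⟩ * cs.simple ⟨i + 1, hi⟩ * cs.simple ⟨i, by omega⟩ *
      (cs.simple ⟨i + 1, hi⟩ * cs.simple ⟨i, by omega⟩ * cs.simple ⟨i + 1, hi⟩) = 1 := by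
    simpa only [pow_succ, pow_zero, one_mul, mul_assoc] using h
  rw [mul_eq_one_iff_eq_inv] at h'
  rw [h']
  simp only [mul_inv_rev, inv_simple, mul_assoc]

theorem natSimple_mem_parabolic {j k : ℕ} (h : j < k) :
    cs.natSimple j ∈ cs.parabolic {i | (i : ℕ) < k} := by
  unfold natSimple
  split_ifs
  · exact cs.simple_mem_parabolic h
  · exact one_mem _

/-- The product `s_j s_{j+1} ⋯ s_{j+d-1}`. -/
noncomputable def consecutiveProd (cs : CoxeterSystem (CoxeterMatrix.A m) W) (j : ℕ) : ℕ → W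
  | 0 => 1
  | d + 1 => cs.natSimple j * consecutiveProd cs (j + 1) d

theorem consecutiveProd_succ (j d : ℕ) :
    cs.consecutiveProd j (d + 1) = cs.natSimple j * cs.consecutiveProd (j + 1) d := rfl

theorem natSimple_mul_consecutiveProd_of_lt {i j : ℕ} (hij : i + 1 < j) (d : ℕ) :
    cs.natSimple i * cs.consecutiveProd j d = cs.consecutiveProd j d * cs.natSimple i := by
  induction d generalizing j with
  | zero => simp [consecutiveProd]
  | succ d ih =>
    rw [consecutiveProd_succ, ← mul_assoc, cs.natSimple_comm hij, mul_assoc, ih (by omega),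
      mul_assoc]

/-- `s_{i+1}` commutes with the letters below `s_i`, the braid relation turns `s_{i+1} s_i s_{i+1}`
into `s_i s_{i+1} s_i`, and the last `s_i` commutes with the remaining letters. -/
theorem natSimple_mul_consecutiveProd_of_le {i j d : ℕ} (hij : j ≤ i) (hd : i + 1 < j + d)
    (hm : j + d ≤ m) :
    cs.natSimple (i + 1) * cs.consecutiveProd j d = cs.consecutiveProd j d * cs.natSimple i := by
  induction d generalizing j with
  | zero => omega
  | succ d ih =>
    rw [consecutiveProd_succ]
    rcases hij.lt_or_eq with hij | rfl
    · rw [← mul_assoc, ← cs.natSimple_comm (by omega : j + 1 < i + 1), mul_assoc,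
        ih (by omega) (by omega) (by omega), mul_assoc]
    · obtain _ | d := d
      · omega
      · rw [consecutiveProd_succ, ← mul_assoc, ← mul_assoc, ← cs.natSimple_braid (by omega),
          mul_assoc _ (cs.natSimple j), cs.natSimple_mul_consecutiveProd_of_lt (by omega)]
        simp only [mul_assoc]

theorem permHom_consecutiveProd_apply {j d : ℕ} (h : j + d ≤ m) :
    cs.permHom (cs.consecutiveProd j d) (j + d) = j := by
  induction d generalizing j with
  | zero => simp [consecutiveProd]
  | succ d ih =>
    rw [consecutiveProd_succ, map_mul, Equiv.Perm.mul_apply, ← add_assoc, add_right_comm,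
      ih (by omega), cs.natSimple_of_lt (by omega), permHom_simple, Equiv.swap_apply_right]

/-- Coset representatives of one standard parabolic in the next. The products of this form are
stable under left multiplication by a generator, which is pushed into `u`, extends the consecutive
product, or cancels its first letter. -/
theorem exists_consecutiveProd_mul {k : ℕ} (hk : k + 1 ≤ m) {w : W}
    (hw : w ∈ cs.parabolic {i | (i : ℕ) < k + 1}) :
    ∃ j d u, j + d = k + 1 ∧ u ∈ cs.parabolic {i | (i : ℕ) < k} ∧
      w = cs.consecutiveProd j d * u := by
  have key (i : Fin m) (hi : (i : ℕ) < k + 1) (w : W) (h : ∃ j d u, j + d = k + 1 ∧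
      u ∈ cs.parabolic {i | (i : ℕ) < k} ∧ w = cs.consecutiveProd j d * u) :
      ∃ j d u, j + d = k + 1 ∧ u ∈ cs.parabolic {i | (i : ℕ) < k} ∧
        cs.simple i * w = cs.consecutiveProd j d * u := by
    obtain ⟨j, d, u, hjd, hu, rfl⟩ := h
    rw [show cs.simple i = cs.natSimple i from (cs.natSimple_of_lt i.2).symm, ← mul_assoc]
    generalize (i : ℕ) = i at hi
    rcases lt_trichotomy (i + 1) j with hij | rfl | hij
    · exact ⟨j, d, cs.natSimple i * u, hjd, mul_mem (cs.natSimple_mem_parabolic (by omega)) hu,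
        by rw [cs.natSimple_mul_consecutiveProd_of_lt hij, mul_assoc]⟩
    · exact ⟨i, d + 1, u, by omega, hu, rfl⟩
    · rcases (Nat.lt_succ_iff.mp hij).lt_or_eq with hij | rfl
      · obtain _ | i := i
        · omega
        · exact ⟨j, d, cs.natSimple i * u, hjd,
            mul_mem (cs.natSimple_mem_parabolic (by omega)) hu, by
              rw [cs.natSimple_mul_consecutiveProd_of_le (by omega) (by omega) (by omega),
                mul_assoc]⟩
      · obtain _ | d := d
        · omega
        · exact ⟨j + 1, d, u, by omega, hu, by
            rw [consecutiveProd_succ, ← mul_assoc, natSimple_mul_self, one_mul]⟩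
  induction hw using Subgroup.closure_induction_left with
  | one => exact ⟨k + 1, 0, 1, rfl, one_mem _, by simp [consecutiveProd]⟩
  | mul_left x hx y _ ih =>
    obtain ⟨i, hi, rfl⟩ := hx
    exact key i hi y ih
  | inv_mul_cancel x hx y _ ih =>
    obtain ⟨i, hi, rfl⟩ := hx
    rw [inv_simple]
    exact key i hi y ih

/-- Since `u` fixes `k + 1`, the image of `k + 1` under the permutation is the index `j` of the
coset representative. A trivial permutation forces that representative to be `1`, and the claim
descends to the smaller parabolic. -/
theorem eq_one_of_permHom_eq_one {w : W} (h : cs.permHom w = 1) : w = 1 := by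
  have key (k : ℕ) (hk : k ≤ m) (w : W) (hw : w ∈ cs.parabolic {i | (i : ℕ) < k})
      (h : cs.permHom w = 1) : w = 1 := by
    induction k generalizing w with
    | zero => simpa [parabolic] using hw
    | succ k ih =>
      obtain ⟨j, d, u, hjd, hu, rfl⟩ := cs.exists_consecutiveProd_mul hk hw
      have h1 := Equiv.congr_fun h (k + 1)
      rw [map_mul, Equiv.Perm.mul_apply, cs.permHom_apply_of_mem_parabolic hu (by omega), ← hjd,
        cs.permHom_consecutiveProd_apply (by omega), Equiv.Perm.one_apply] at h1
      obtain rfl : d = 0 := by omega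
      have e : cs.consecutiveProd j 0 * u = u := one_mul u
      rw [e] at h ⊢
      exact ih (by omega) u hu h
  refine key m le_rfl w ?_ h
  have e : {i : Fin m | (i : ℕ) < m} = Set.univ := Set.eq_univ_of_forall fun i => i.2
  rw [e, parabolic_univ]
  trivial

theorem IsSigma.eq_rev [Finite W] {cs : CoxeterSystem (CoxeterMatrix.A m) W}
    {σ : Equiv.Perm (Fin m)} (hσ : cs.IsSigma σ) (i : Fin m) : σ i = i.rev := by
  set g := cs.permHom (cs.longest Set.univ) with hg
  -- Conjugating a transposition by `g` relabels its two points, so `g` takes neighbours to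
  -- neighbours.
  have hswap (i : Fin m) :
      Equiv.swap (g i) (g (i + 1)) = Equiv.swap (σ i : ℕ) (σ i + 1) := by
    have h := congrArg cs.permHom (hσ i)
    have hinv : cs.longest Set.univ = (cs.longest Set.univ)⁻¹ :=
      (inv_eq_of_mul_eq_one_left cs.longest_mul_longest).symm
    nth_rw 2 [hinv] at h
    rw [map_mul, map_mul, map_inv, permHom_simple, permHom_simple, ← hg] at h
    rw [← h, Equiv.swap_apply_apply]
  have hpair (i : Fin m) : (g i = σ i ∧ g (i + 1) = σ i + 1) ∨
      (g i = σ i + 1 ∧ g (i + 1) = σ i) := by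
    have h1 := Equiv.congr_fun (hswap i) (g i)
    have h2 : g (i + 1) ≠ g i := fun h => by
      have := g.injective h
      omega
    rw [Equiv.swap_apply_left, Equiv.swap_apply_def] at h1
    split_ifs at h1 with h3 h4
    · exact Or.inl ⟨h3, h1⟩
    · exact Or.inr ⟨h4, h1⟩
    · exact absurd h1 h2
  have hfix (x : ℕ) (hx : m < x) : g x = x := by
    refine cs.permHom_apply_of_mem_parabolic (k := m) ?_ hx
    have e : {i : Fin m | (i : ℕ) < m} = Set.univ := Set.eq_univ_of_forall fun i => i.2
    rw [e]
    exact cs.longest_mem _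
  rcases Equiv.Perm.eq_one_or_forall_eq_sub hfix (fun i hi => by
    have := hpair ⟨i, hi⟩
    dsimp only at this
    omega) with h1 | h1
  -- The identity is impossible: it would give `w₀ = 1`, yet `w₀ s_i` is shorter than `w₀`.
  · have h2 := cs.eq_one_of_permHom_eq_one h1
    have h3 := cs.length_longest_mul_simple (Set.mem_univ i)
    rw [h2, length_one] at h3
    omega
  · have h2 := hpair i
    have h3 := i.2
    rw [h1 i (by omega), h1 (i + 1) (by omega)] at h2
    apply Fin.ext
    rw [Fin.val_rev]
    omega

end TypeA

end CoxeterSystem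

theorem mainTheorem10 {F : Type*} [Field F] :
    (∀ {B W : Type*} [Group W] [Finite W] {M : CoxeterMatrix B} (cs : CoxeterSystem M W),
      (∃! φ : HeckeZero F M ≃ₐ[F] HeckeZero F M, cs.IsPhi F φ) ∧
      (∃! σ : Equiv.Perm B, cs.IsSigma σ) ∧
      ∀ (φ : HeckeZero F M ≃ₐ[F] HeckeZero F M) (σ : Equiv.Perm B),
        cs.IsPhi F φ → cs.IsSigma σ →
        (∀ i j, M (σ i) (σ j) = M i j) ∧
        (∀ i, φ (HeckeZero.gen F M i) = HeckeZero.gen F M (σ i)) ∧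
        (∀ x, HeckeZero.theta F M (HeckeZero.theta F M x) = x) ∧
        (∀ x, φ (φ x) = x) ∧
        (∀ x, HeckeZero.theta F M (φ x) = φ (HeckeZero.theta F M x)) ∧
        ∀ I : Set B,
          Nonempty (imageIdeal (HeckeZero.theta F M) (cs.proj F I)
            ≃ₗ[HeckeZero F M] cs.proj F Iᶜ) ∧
          Nonempty (cs.proj F Iᶜ
            ≃ₗ[HeckeZero F M] Twist (HeckeZero.theta F M) (cs.proj F I)) ∧
          imageIdeal φ (cs.proj F I) = cs.proj F (σ '' I) ∧
          Nonempty (cs.proj F (σ '' I) ≃ₗ[HeckeZero F M] Twist φ (cs.proj F I))) ∧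
    (∀ (n : ℕ) {W : Type*} [Group W] [Finite W] {M : CoxeterMatrix (Fin (n - 1))}
      (cs : CoxeterSystem M W) (φ : HeckeZero F M ≃ₐ[F] HeckeZero F M),
        M = CoxeterMatrix.A (n - 1) → cs.IsPhi F φ →
        (∀ i, φ (HeckeZero.gen F M i) = HeckeZero.gen F M i.rev) ∧
        ∀ α : Composition n,
          Nonempty (Twist φ (Twist (HeckeZero.theta F M) (cs.top F α.descentSet))
            ≃ₗ[HeckeZero F M] cs.top F α.transpose.descentSet) ∧
          Nonempty (imageIdeal φ (imageIdeal (HeckeZero.theta F M) (cs.proj F α.descentSet))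
            ≃ₗ[HeckeZero F M]
              Twist φ (Twist (HeckeZero.theta F M) (cs.proj F α.descentSet))) ∧
          Nonempty (Twist φ (Twist (HeckeZero.theta F M) (cs.proj F α.descentSet))
            ≃ₗ[HeckeZero F M] cs.proj F α.transpose.descentSet)) := by
  refine ⟨fun {B W} _ _ {M} cs => ⟨cs.exists_unique_isPhi F, cs.exists_unique_isSigma,
    fun φ σ hφ hσ => ⟨hσ.coxeterMatrix_apply, hφ.apply_gen hσ, HeckeZero.theta_theta F M,
      hφ.involutive, hφ.theta_comm, fun I => ⟨cs.nonempty_imageIdeal_theta_equiv F I,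
        cs.nonempty_proj_compl_equiv_twist F I, hφ.imageIdeal_proj hσ I,
        hφ.nonempty_proj_equiv_twist hσ I⟩⟩⟩, ?_⟩
  rintro n W _ _ M cs φ rfl hφ
  obtain ⟨σ, hσ, -⟩ := cs.exists_unique_isSigma
  refine ⟨fun i => by rw [hφ.apply_gen hσ, hσ.eq_rev], fun α => ?_⟩
  have hα : α.transpose.descentSet = σ '' α.descentSetᶜ := by
    rw [Composition.descentSet_transpose]
    exact Set.image_congr fun i _ => (hσ.eq_rev i).symm
  obtain ⟨e1⟩ := cs.nonempty_proj_compl_equiv_twist F α.descentSet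
  obtain ⟨e2⟩ := hφ.nonempty_proj_equiv_twist hσ α.descentSetᶜ
  -- First `θ` replaces the descent set by its complement, then `φ` applies `σ`; by `hα` the result
  -- is the descent set of the transpose. The statement on tops follows by carrying both twists
  -- through the quotient by the radical.
  let e := (e2.trans (Twist.congr φ e1)).symm
  rw [hα]
  exact ⟨⟨((Twist.congr φ (Twist.quotientJacobsonEquiv _ _)).trans
      (Twist.quotientJacobsonEquiv φ _)).trans e.quotientJacobson⟩,
    ⟨(imageIdealEquivTwist φ hφ.involutive _).trans
      (Twist.congr φ (imageIdealEquivTwist _ (HeckeZero.theta_theta F _) _))⟩, ⟨e⟩⟩
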